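/- **Setting.** Let $\varphi,\psi:\mathbb R\to\mathbb R$ be measurable and compactly supported, $\psi$ bounded, let $g^{per}_{j,k}(x)=\sum_{l\in\mathbb Z}2^{j/2}g(2^j(x-l)-k)$ for $g\in\{\varphi,\psi\}$, and let $\tau\ge 0$ be an integer such that $\{\varphi^{per}_{\tau,k}:0\le k<2^\tau\}\cup\{\psi^{per}_{j,k}:j\ge\tau,\ 0\le k<2^j\}$ is an orthonormal basis of $L^2([0,1])$ (periodized wavelet basis; the superscript is dropped below). For $f$ on $[0,1]$ put $\alpha_{j,k}=\int_0^1 f\varphi_{j,k}$, $\beta_{j,k}=\int_0^1 f\psi_{j,k}$. For $p,q\in[1,\infty]$, $s>0$, $L>0$, the Besov ball $B^s_{p,q}(L)$ is the set of $f$ such that the $\ell^q$ norm over $j\ge\tau-1$ of the sequence $2^{j(s+1/2-1/p)}\|(\beta_{j,k})_k\|_{\ell^p}$ is at most $L$, where for $j=\tau-1$ the family $(\beta_{\tau-1,k})_k$ stands for $(\alpha_{\tau,k})_{0\le k<2^\tau}$. *Thresholding rule.* $(\Upsilon_u)_{u\ge0}$ are measurable functions $\mathbb R\to\mathbb R$ for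 which there are $C_1,C_2>0$ with $$|\Upsilon_u(x)-y|^2\le C_1\Big(\min(|y|,C_2u)^2+|x-y|^2\mathbf 1_{\{|x-y|\ge u/2\}}\Big)\qquad\text{for all }u\ge0,\ x,y\in\mathbb R$$ (so $\Upsilon_0(x)=x$; hard, soft and non-negative garrote thresholding qualify). *Estimator.* Let $X_1,\dots,X_n$ be i.i.d. on $[0,1]$ with density $f^*$, $0\le f^*\le B$ a.e., where $B\ge1$. Put $l=\lceil n/\log n\rceil$, $m=n-l$, and let $j_1$ be the integer with $m/\log m\le 2^{j_1}<2m/\log m$ ($\log$ is the natural logarithm; for $n\ge 6$ one has $m\ge2$, so that all this is defined). From the first $m$ observations form $\hat\alpha_{j,k}=\frac1m\sum_{i\le m}\varphi_{j,k}(X_i)$ and $\hat\beta_{j,k}=\frac1m\sum_{i\le m}\psi_{j,k}(X_i)$ and, for $u\in\Lambda_n=\{0,1,\dots,\lfloor\log_2 n\rfloor\}$, $$\hat f_u=\sum_{k=0}^{2^\tau-1}\hat\alpha_{\tau,k}\varphi_{\tau,k}+\sum_{j=\tau}^{j_1}\sum_{k=0}^{2^j-1}\Upsilon_{\rho\sqrt{(j-u)_+/m}}(\hat\beta_{j,k})\,\psi_{j,k},\qquad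 g_u=\max(0,\min(\hat f_u,B)).$$ From the last $l$ observations form $A^{(l)}(g)=\frac1l\sum_{i=m+1}^n\big(\int_0^1g^2-2g(X_i)\big)$ and the multi-thresholding estimator $$\tilde f_n=\sum_{u\in\Lambda_n}\frac{\exp(-lA^{(l)}(g_u))}{\sum_{\gamma\in\Lambda_n}\exp(-lA^{(l)}(g_\gamma))}\,g_u .$$ **Theorem.** Let $B\ge1$, $L>0$, $N\in\mathbb R$, and let $\rho>0$ satisfy $$\frac{\rho^2}{8B+\frac{8\rho}{3\sqrt2}(\|\psi\|_\infty+B)}\ge4\log2 .$$ Then for every $s_0>0$ there is a constant $C>0$ (depending only on $\varphi,\psi,\tau,\Upsilon,B,L,\rho,N,s_0$) such that for all $p,q\in[1,\infty]$, all $s\in(1/p,N]$ with $s\ge s_0$, and all integers $n\ge6$, $$\sup_{f^*}\ \mathbb E\big[\|\tilde f_n-f^*\|^2_{L^2([0,1])}\big]\le C\,n^{-2s/(2s+1)},$$ the supremum being over all probability densities $f^*$ on $[0,1]$ bounded by $B$ that belong to $B^s_{p,q}(L)$. In particular, the same estimator, which does not depend on $s,p,q,L$, attains the rate without a logarithmic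 factor. -/

import Mathlib

open MeasureTheory
open scoped ENNReal

namespace MultiThreshold

noncomputable section

/-! ### Periodized wavelets and Besov balls -/

/-- Lebesgue measure on `[0,1]`. -/
def unitMeasure : Measure ℝ := volume.restrict (Set.Icc 0 1)

/-- The periodized function `g_{j,k}^{per}(x) = ∑_{l ∈ ℤ} 2^{j/2} g(2^j (x - l) - k)`. -/
def periodized (g : ℝ → ℝ) (j k : ℕ) (x : ℝ) : ℝ :=
  ∑' l : ℤ, (2 : ℝ) ^ ((j : ℝ) / 2) * g (2 ^ j * (x - l) - k)

/-- `φ` and `ψ` are compactly supported, `ψ` is bounded, and `τ` is a level such that the functions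
`φ_{τ,k}^{per}` (`k < 2^τ`) and `ψ_{j,k}^{per}` (`j = τ + i`, `i ≥ 0`, `k < 2^j`) form an
orthonormal (Hilbert) basis of `L²([0,1])`. -/
structure IsPeriodizedWaveletBasis (φ ψ : ℝ → ℝ) (τ : ℕ) : Prop where
  measurable_father : Measurable φ
  measurable_mother : Measurable ψ
  compact_father : HasCompactSupport φ
  compact_mother : HasCompactSupport ψ
  bounded_mother : MemLp ψ ∞ volume
  hilbertBasis :
    ∃ b : HilbertBasis (Fin (2 ^ τ) ⊕ (Σ i : ℕ, Fin (2 ^ (τ + i)))) ℝ (Lp ℝ 2 unitMeasure),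
      (∀ k : Fin (2 ^ τ), (b (Sum.inl k) : ℝ → ℝ) =ᵐ[unitMeasure] periodized φ τ k) ∧
      (∀ (i : ℕ) (k : Fin (2 ^ (τ + i))),
        (b (Sum.inr ⟨i, k⟩) : ℝ → ℝ) =ᵐ[unitMeasure] periodized ψ (τ + i) k)

/-- The sup norm `‖g‖_∞` (essential supremum over `ℝ`). -/
def supNorm (g : ℝ → ℝ) : ℝ := (eLpNorm g ∞ volume).toReal

/-- The coefficient `∫₀¹ f(x) e(x) dx`. -/
def coeff (f e : ℝ → ℝ) : ℝ := ∫ x, f x * e x ∂unitMeasure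

/-- The `ℓ^r` norm, with value in `[0,∞]`, of a family of numbers in `[0,∞]`; it is the supremum if
`r = ∞`. -/
def lNorm {ι : Type} (r : ℝ≥0∞) (a : ι → ℝ≥0∞) : ℝ≥0∞ :=
  if r = ∞ then ⨆ i, a i else (∑' i, a i ^ r.toReal) ^ (1 / r.toReal)

/-- The contribution of each level to the Besov norm. Index `0` is the level `τ - 1`, whose
coefficients are by convention the `2^τ` numbers `α_{τ,k}`; index `i + 1` is the level `τ + i`. The
weight of level `j` is `2^{j(s + 1/2 - 1/p)}`, and `1/p = 0` for `p = ∞`. -/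
def besovLevel (φ ψ : ℝ → ℝ) (τ : ℕ) (s : ℝ) (p : ℝ≥0∞) (f : ℝ → ℝ) : ℕ → ℝ≥0∞
  | 0 => ENNReal.ofReal ((2 : ℝ) ^ (((τ : ℝ) - 1) * (s + 1 / 2 - (p⁻¹).toReal))) *
      lNorm p (fun k : Fin (2 ^ τ) => ‖coeff f (periodized φ τ k)‖ₑ)
  | i + 1 => ENNReal.ofReal ((2 : ℝ) ^ (((τ + i : ℕ) : ℝ) * (s + 1 / 2 - (p⁻¹).toReal))) *
      lNorm p (fun k : Fin (2 ^ (τ + i)) => ‖coeff f (periodized ψ (τ + i) k)‖ₑ)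

/-- The Besov ball `B^s_{p,q}(L)`, through wavelet coefficients. -/
def besovBall (φ ψ : ℝ → ℝ) (τ : ℕ) (s : ℝ) (p q : ℝ≥0∞) (L : ℝ) : Set (ℝ → ℝ) :=
  {f | lNorm q (besovLevel φ ψ τ s p f) ≤ ENNReal.ofReal L}

/-! ### The density model -/

/-- `f` is (a version of) a probability density on `[0,1]` that is bounded by `B`. -/
structure IsBoundedDensity (B : ℝ) (f : ℝ → ℝ) : Prop where
  measurable : Measurable f
  nonneg : ∀ᵐ x ∂unitMeasure, 0 ≤ f x
  le_bound : ∀ᵐ x ∂unitMeasure, f x ≤ B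
  integral_eq_one : ∫ x, f x ∂unitMeasure = 1

/-- The probability distribution on `[0,1]` with density `f`. -/
def densityLaw (f : ℝ → ℝ) : Measure ℝ :=
  unitMeasure.withDensity (fun x => ENNReal.ofReal (f x))

/-! ### Term-by-term thresholded estimators -/

/-- The family `Υ_u`, `u ≥ 0`, of thresholding operators. At `u = 0` the inequality says that
`Υ_0` is the identity. -/
structure IsThresholdingRule (Υ : ℝ → ℝ → ℝ) : Prop where
  measurable : ∀ u, 0 ≤ u → Measurable (Υ u)
  bound : ∃ C₁ > 0, ∃ C₂ > 0, ∀ u, 0 ≤ u → ∀ x y : ℝ,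
    |Υ u x - y| ^ 2 ≤
      C₁ * ((min |y| (C₂ * u)) ^ 2 + (if u / 2 ≤ |x - y| then |x - y| ^ 2 else 0))

/-- The empirical coefficient `(1/m) ∑_{i} e(D_i)` built from a sample `D` of size `m`. -/
def empCoeff {m : ℕ} (D : Fin m → ℝ) (e : ℝ → ℝ) : ℝ := (1 / (m : ℝ)) * ∑ i, e (D i)

/-- The finest level `j₁` for a sample of size `m`; see `finestLevel_spec`. -/
def finestLevel (m : ℕ) : ℕ := ⌈Real.logb 2 ((m : ℝ) / Real.log m)⌉₊

/-- The integer `j₁` satisfies `m / log m ≤ 2^{j₁} < 2 m / log m`. -/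
theorem finestLevel_spec {m : ℕ} (hm : 2 ≤ m) :
    (m : ℝ) / Real.log m ≤ 2 ^ finestLevel m ∧
      (2 : ℝ) ^ finestLevel m < 2 * ((m : ℝ) / Real.log m) := by
  have hm' : (2 : ℝ) ≤ m := by exact_mod_cast hm
  have hlog : 0 < Real.log m := Real.log_pos (by linarith)
  have hle : Real.log m ≤ m := by
    have := Real.log_le_sub_one_of_pos (show (0 : ℝ) < m by linarith)
    linarith
  have h1 : 1 ≤ (m : ℝ) / Real.log m := by rwa [le_div_iff₀ hlog, one_mul]
  have hpos : 0 < (m : ℝ) / Real.log m := by linarith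
  have h0 : 0 ≤ Real.logb 2 ((m : ℝ) / Real.log m) := Real.logb_nonneg (by norm_num) h1
  constructor
  · have := Nat.le_ceil (Real.logb 2 ((m : ℝ) / Real.log m))
    rw [Real.logb_le_iff_le_rpow (by norm_num) hpos, Real.rpow_natCast] at this
    exact this
  · have := Nat.ceil_lt_add_one h0
    have h2 : ((finestLevel m : ℕ) : ℝ) - 1 < Real.logb 2 ((m : ℝ) / Real.log m) := by
      unfold finestLevel
      linarith
    rw [Real.lt_logb_iff_rpow_lt (by norm_num) hpos, Real.rpow_sub_one (by norm_num),
      Real.rpow_natCast] at h2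
    linarith

/-- The thresholded estimator `f̂_λ(D, ·)` built from a sample `D` of size `m`, with threshold
`thr j` at level `j`. -/
def thresholdedEstimator (φ ψ : ℝ → ℝ) (τ : ℕ) (Υ : ℝ → ℝ → ℝ) (thr : ℕ → ℝ) {m : ℕ}
    (D : Fin m → ℝ) (x : ℝ) : ℝ :=
  ∑ k ∈ Finset.range (2 ^ τ), empCoeff D (periodized φ τ k) * periodized φ τ k x +
    ∑ j ∈ Finset.Icc τ (finestLevel m), ∑ k ∈ Finset.range (2 ^ j),
      Υ (thr j) (empCoeff D (periodized ψ j k)) * periodized ψ j k x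

/-- The threshold `v_u = (ρ √((j - u)₊ / m))_j` for a sample of size `m`
(natural-number subtraction is the positive part). -/
def threshold (ρ : ℝ) (m u j : ℕ) : ℝ := ρ * Real.sqrt (((j - u : ℕ) : ℝ) / m)

/-! ### The multi-thresholding estimator -/

/-- The size `l = ⌈n / log n⌉` of the learning sample. -/
def learnSize (n : ℕ) : ℕ := ⌈(n : ℝ) / Real.log n⌉₊

/-- The size `m = n - l` of the training sample. -/
def trainSize (n : ℕ) : ℕ := n - learnSize n

/-- The training sample `D_m`: the first `m` observations. -/
def trainSample {n : ℕ} (X : Fin n → ℝ) : Fin (trainSize n) → ℝ :=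
  fun i => X (Fin.castLE (Nat.sub_le n (learnSize n)) i)

/-- The index set `Λ_n = {0, …, ⌊log₂ n⌋}`. -/
def indexSet (n : ℕ) : Finset ℕ := Finset.range (Nat.log 2 n + 1)

/-- The projection `h_{a,b}` onto the interval `[a,b]`. -/
def clip (a b y : ℝ) : ℝ := max a (min y b)

/-- The clipped estimator `h_{0,B}(f̂_{v_u}(D_m, ·))`. -/
def clippedEstimator (φ ψ : ℝ → ℝ) (τ : ℕ) (Υ : ℝ → ℝ → ℝ) (B ρ : ℝ) {n : ℕ}
    (X : Fin n → ℝ) (u : ℕ) (x : ℝ) : ℝ :=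
  clip 0 B (thresholdedEstimator φ ψ τ Υ (threshold ρ (trainSize n) u) (trainSample X) x)

/-- The quadratic loss `Q(z, f) = ∫₀¹ f² - 2 f(z)` of the density model. -/
def quadLoss (z : ℝ) (f : ℝ → ℝ) : ℝ := (∫ x, f x ^ 2 ∂unitMeasure) - 2 * f z

/-- The empirical risk `A^{(l)}(f)` on the last `l` observations. -/
def learnRisk {n : ℕ} (X : Fin n → ℝ) (f : ℝ → ℝ) : ℝ :=
  (1 / (learnSize n : ℝ)) *
    ∑ i ∈ Finset.univ.filter (fun i : Fin n => trainSize n ≤ (i : ℕ)), quadLoss (X i) f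

/-- The exponential weight of the index `u`. -/
def weight (φ ψ : ℝ → ℝ) (τ : ℕ) (Υ : ℝ → ℝ → ℝ) (B ρ : ℝ) {n : ℕ}
    (X : Fin n → ℝ) (u : ℕ) : ℝ :=
  Real.exp (-(learnSize n : ℝ) * learnRisk X (clippedEstimator φ ψ τ Υ B ρ X u)) /
    ∑ γ ∈ indexSet n,
      Real.exp (-(learnSize n : ℝ) * learnRisk X (clippedEstimator φ ψ τ Υ B ρ X γ))

/-- The multi-thresholding estimator `f̃_n` evaluated at the data `X` and the point `x`. -/
def multiThresholdEstimator (φ ψ : ℝ → ℝ) (τ : ℕ) (Υ : ℝ → ℝ → ℝ) (B ρ : ℝ) {n : ℕ}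
    (X : Fin n → ℝ) (x : ℝ) : ℝ :=
  ∑ u ∈ indexSet n, weight φ ψ τ Υ B ρ X u * clippedEstimator φ ψ τ Υ B ρ X u x

/-- The risk `E ‖f̃ - f‖²_{L²([0,1])}` of an estimator built from `n` i.i.d. observations with
density `f`, as an element of `[0,∞]`. -/
def risk {n : ℕ} (est : (Fin n → ℝ) → ℝ → ℝ) (f : ℝ → ℝ) : ℝ≥0∞ :=
  ∫⁻ X, (∫⁻ x, ENNReal.ofReal ((est X x - f x) ^ 2) ∂unitMeasure)
    ∂(Measure.pi (fun _ : Fin n => densityLaw f))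

end

end MultiThreshold

namespace MultiThreshold

/-! ### Periodized functions -/

/-! The proof separates aggregation from estimation. Given the training sample, the clipped
estimators are fixed functions with values in `[0,B]`. For the quadratic loss the excess risk is
exactly the squared `L²` distance, and since the density is at most `B`, the variance of an excess
loss is at most a constant times its mean. Exponential weights therefore lose only a factor 3 and an
additive `O(log n / l) = O(log² n / n)` against any single candidate (`sum_expWeight_mul_le`,
`risk_multiThresholdEstimator_le`). This term is below the rate, uniformly for `s ≤ N`, so one good
candidate suffices.

The good candidate is the balancing level `u` with `2^{u(2s+1)} ≈ m`, which lies in the index set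
whatever `s` is. By Parseval and the thresholding inequality its risk is a sum over levels `j`. Up
to `u` there is no threshold, and the variance `2^j B / m` sums geometrically to `2^u / m`, which is
at most the rate. At `j = u + d` with `d ≥ 1` the threshold is of order `√(d/m)`. A Bernstein bound
(`lintegral_empCoeff_sub_sq_tail_le`) makes each deviation at most of order `(d/m) 2^{-1.1 d}`,
which beats the `2^d` growth in the number of coefficients. The bias `∑ min(|β|, C√(d/m))²` is
interpolated between the Besov norm and the threshold and gives `d 2^{-η d} 2^{-2su}`
(`sum_min_coeff_sq_le`). Above the finest level the whole energy is lost, but it is already below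
the rate (`exists_two_rpow_finestLevel_le`). Each contribution is thus the rate times a summable
function of the distance to `u` or to the finest level, apart from finitely many coarse levels of
cost `O(1/m)`. No logarithm appears, because the threshold grows with `j - u` and not with `log m`.
-/

theorem measurable_periodized {g : ℝ → ℝ} (hg : Measurable g) (j k : ℕ) :
    Measurable (periodized g j k) := by
  unfold periodized
  exact Measurable.tsum fun l => (hg.comp (by fun_prop)).const_mul _

/-- Nondegenerate affine maps pull null sets back to null sets. This carries the essential bound on
the mother wavelet to all its dilates and translates. -/
theorem ae_comp_mul_sub_sub {p : ℝ → Prop} (hp : ∀ᵐ y, p y) {a : ℝ} (ha : a ≠ 0) (b c : ℝ) :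
    ∀ᵐ x, p (a * (x - b) - c) := by
  have h1 : Measure.QuasiMeasurePreserving (fun x : ℝ => a * x) volume volume :=
    ⟨by fun_prop, by
      rw [Real.map_volume_mul_left ha]; exact Measure.smul_absolutelyContinuous⟩
  have h2 := (measurePreserving_sub_right (volume : Measure ℝ) b).quasiMeasurePreserving
  have h3 := (measurePreserving_sub_right (volume : Measure ℝ) c).quasiMeasurePreserving
  exact ((h3.comp h1).comp h2).ae hp

theorem ae_abs_le_supNorm {g : ℝ → ℝ} (hg : MemLp g ∞ volume) : ∀ᵐ x, |g x| ≤ supNorm g := by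
  have h := ae_le_eLpNormEssSup (f := g) (μ := volume)
  filter_upwards [h] with x hx
  rw [← eLpNorm_exponent_top] at hx
  have := ENNReal.toReal_mono hg.eLpNorm_lt_top.ne hx
  simpa [supNorm] using this

/-- At fine levels the translates in a periodized function do not overlap, so that the sup norm
just scales. -/
theorem exists_level_abs_periodized_le {g : ℝ → ℝ} (hg : HasCompactSupport g)
    (hb : MemLp g ∞ volume) :
    ∃ J : ℕ, ∀ j, J ≤ j → ∀ k,
      ∀ᵐ x, |periodized g j k x| ≤ (2 : ℝ) ^ ((j : ℝ) / 2) * supNorm g := by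
  obtain ⟨R, hR⟩ := hg.isCompact.isBounded.exists_norm_le
  have hR' : ∀ x, g x ≠ 0 → |x| ≤ R := fun x hx => hR x (subset_tsupport g hx)
  -- The support of `g` has diameter at most `2R`, while changing `l` moves the argument of `g` by
  -- at least `2^j`. Once `2^j > 2R`, at most one term of the series is nonzero.
  obtain ⟨J, hJ⟩ := pow_unbounded_of_one_lt (2 * R) (one_lt_two (α := ℝ))
  refine ⟨J, fun j hj k => ?_⟩
  have hj2 : 2 * R < 2 ^ j := hJ.trans_le (pow_le_pow_right₀ one_le_two hj)
  have hall : ∀ᵐ x : ℝ, ∀ l : ℤ, |g (2 ^ j * (x - l) - k)| ≤ supNorm g :=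
    ae_all_iff.2 fun l => ae_comp_mul_sub_sub (ae_abs_le_supNorm hb) (by positivity) _ _
  filter_upwards [hall] with x hx
  have hS : 0 ≤ supNorm g := ENNReal.toReal_nonneg
  unfold periodized
  by_cases h : ∃ l : ℤ, g (2 ^ j * (x - l) - k) ≠ 0
  · obtain ⟨l, hl⟩ := h
    rw [tsum_eq_single l]
    · rw [abs_mul, abs_of_pos (by positivity)]
      exact mul_le_mul_of_nonneg_left (hx l) (by positivity)
    · intro l' hl'
      by_contra hne
      have h1 := hR' _ hl
      have h2 := hR' _ (right_ne_zero_of_mul hne)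
      have h3 : |(2 : ℝ) ^ j * ((l : ℝ) - l')| ≤ 2 * R := by
        have : (2 : ℝ) ^ j * ((l : ℝ) - l') =
          (2 ^ j * (x - l') - k) - (2 ^ j * (x - l) - k) := by ring
        rw [this]
        exact (abs_sub _ _).trans (by linarith)
      have h4 : (1 : ℝ) ≤ |(l : ℝ) - l'| := by
        have : (1 : ℤ) ≤ |l - l'| := Int.one_le_abs (sub_ne_zero.2 (Ne.symm hl'))
        exact_mod_cast this
      rw [abs_mul, abs_of_pos (by positivity : (0 : ℝ) < 2 ^ j)] at h3
      nlinarith [pow_pos (two_pos (α := ℝ)) j]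
  · push Not at h
    simp only [h, mul_zero, tsum_zero, abs_zero]
    positivity

/-! ### The law of one observation -/

instance : IsProbabilityMeasure unitMeasure := ⟨by simp [unitMeasure]⟩

theorem IsBoundedDensity.isProbabilityMeasure {B : ℝ} {f : ℝ → ℝ} (hf : IsBoundedDensity B f) :
    IsProbabilityMeasure (densityLaw f) := by
  refine ⟨?_⟩
  have hint : Integrable f unitMeasure := by
    by_contra h
    have := hf.integral_eq_one
    rw [integral_undef h] at this
    norm_num at this
  rw [densityLaw, withDensity_apply _ MeasurableSet.univ, Measure.restrict_univ,
    ← ofReal_integral_eq_lintegral_ofReal hint hf.nonneg, hf.integral_eq_one, ENNReal.ofReal_one]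

theorem densityLaw_absolutelyContinuous (f : ℝ → ℝ) : densityLaw f ≪ unitMeasure :=
  withDensity_absolutelyContinuous _ _

theorem lintegral_densityLaw_le {B : ℝ} {f : ℝ → ℝ} (hf : IsBoundedDensity B f) {g : ℝ → ℝ≥0∞}
    (hg : Measurable g) :
    ∫⁻ x, g x ∂densityLaw f ≤ ENNReal.ofReal B * ∫⁻ x, g x ∂unitMeasure := by
  rw [densityLaw, lintegral_withDensity_eq_lintegral_mul _ hf.measurable.ennreal_ofReal hg,
    ← lintegral_const_mul _ hg]
  refine lintegral_mono_ae ?_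
  filter_upwards [hf.le_bound] with x hx
  exact mul_le_mul_left (ENNReal.ofReal_le_ofReal hx) _

theorem integral_densityLaw {B : ℝ} {f : ℝ → ℝ} (hf : IsBoundedDensity B f) (e : ℝ → ℝ) :
    ∫ x, e x ∂densityLaw f = coeff f e := by
  rw [densityLaw, integral_withDensity_eq_integral_toReal_smul hf.measurable.ennreal_ofReal
    (by simp), coeff]
  refine integral_congr_ae ?_
  filter_upwards [hf.nonneg] with x hx
  rw [ENNReal.toReal_ofReal hx, smul_eq_mul]

/-- A function of `L²([0,1])` norm at most `1` has second moment at most `B` under a density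
bounded by `B`. -/
theorem memLp_two_densityLaw {B : ℝ} (hB : 0 ≤ B) {f : ℝ → ℝ} (hf : IsBoundedDensity B f)
    {e : ℝ → ℝ} (he : Measurable e)
    (h : ∫⁻ x, ENNReal.ofReal (e x ^ 2) ∂unitMeasure ≤ 1) :
    MemLp e 2 (densityLaw f) ∧ ∫ x, e x ^ 2 ∂densityLaw f ≤ B := by
  have h1 : ∫⁻ x, ENNReal.ofReal (e x ^ 2) ∂densityLaw f ≤ ENNReal.ofReal B := by
    refine (lintegral_densityLaw_le hf (he.pow_const 2).ennreal_ofReal).trans ?_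
    calc _ ≤ ENNReal.ofReal B * 1 := by gcongr
      _ = _ := mul_one _
  constructor
  · rw [memLp_two_iff_integrable_sq he.aestronglyMeasurable]
    refine ⟨(he.pow_const 2).aestronglyMeasurable, ?_⟩
    rw [hasFiniteIntegral_iff_ofReal (ae_of_all _ fun x => sq_nonneg _)]
    exact h1.trans_lt ENNReal.ofReal_lt_top
  · rw [integral_eq_lintegral_of_nonneg_ae (ae_of_all _ fun x => sq_nonneg _)
      (he.pow_const 2).aestronglyMeasurable]
    exact ENNReal.toReal_le_of_le_ofReal hB h1

/-! ### Product measures -/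

section Pi

variable {P : Measure ℝ} [IsProbabilityMeasure P]

theorem map_comp_pi {m n : ℕ} {ι : Fin m → Fin n} (hι : Function.Injective ι) :
    (Measure.pi fun _ : Fin n => P).map (fun X => X ∘ ι) = Measure.pi fun _ : Fin m => P := by
  have h := ProbabilityTheory.iIndepFun_pi (μ := fun _ : Fin n => P) (X := fun _ x => x)
    (fun _ => aemeasurable_id)
  have h2 := h.precomp hι
  rw [ProbabilityTheory.iIndepFun_iff_map_fun_eq_pi_map
    (fun i => (measurable_pi_apply (ι i)).aemeasurable)] at h2
  refine Eq.trans h2 ?_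
  congr 1
  ext1 i
  exact (measurePreserving_eval (fun _ : Fin n => P) (ι i)).map_eq

theorem map_trainSample_pi (n : ℕ) :
    (Measure.pi fun _ : Fin n => P).map trainSample =
      Measure.pi fun _ : Fin (trainSize n) => P :=
  map_comp_pi (Fin.castLE_injective _)

/-- The sample that takes its first `m` observations from `X` and the others from `Y`. -/
def mergeSample {n : ℕ} (m : ℕ) (Z : (Fin n → ℝ) × (Fin n → ℝ)) : Fin n → ℝ :=
  fun i => if (i : ℕ) < m then Z.1 i else Z.2 i

/-- The sample is split without reindexing: two full independent copies are drawn and each lends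
part of its coordinates. On a box, the unused coordinates contribute mass one. -/
theorem map_mergeSample (n m : ℕ) :
    ((Measure.pi fun _ : Fin n => P).prod (Measure.pi fun _ : Fin n => P)).map (mergeSample m) =
      Measure.pi fun _ : Fin n => P := by
  have hmeas : Measurable (mergeSample (n := n) m) := by
    refine measurable_pi_lambda _ fun i => ?_
    unfold mergeSample
    split_ifs <;> fun_prop
  symm
  refine Measure.pi_eq fun s hs => ?_
  rw [Measure.map_apply hmeas (MeasurableSet.univ_pi hs)]
  have hpre : mergeSample m ⁻¹' Set.univ.pi s =
      (Set.univ.pi fun i : Fin n => if (i : ℕ) < m then s i else Set.univ) ×ˢ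
        (Set.univ.pi fun i : Fin n => if (i : ℕ) < m then Set.univ else s i) := by
    ext Z
    simp only [Set.mem_preimage, Set.mem_univ_pi, Set.mem_prod, mergeSample]
    rw [← forall_and]
    refine forall_congr' fun i => ?_
    split_ifs <;> simp
  rw [hpre, Measure.prod_prod, Measure.pi_pi, Measure.pi_pi, ← Finset.prod_mul_distrib]
  refine Finset.prod_congr rfl fun i _ => ?_
  split_ifs <;> simp

/-- An inequality is enough, and it holds for every `F`. Measurability of the loss as a function of
the data is then never needed. -/
theorem lintegral_pi_le_merge {n : ℕ} (m : ℕ) (F : (Fin n → ℝ) → ℝ≥0∞) :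
    ∫⁻ X, F X ∂(Measure.pi fun _ : Fin n => P) ≤
      ∫⁻ X, ∫⁻ Y, F (mergeSample m (X, Y)) ∂(Measure.pi fun _ : Fin n => P)
        ∂(Measure.pi fun _ : Fin n => P) := by
  conv_lhs => rw [← map_mergeSample (P := P) n m]
  exact (lintegral_map_le _ _).trans (lintegral_prod_le _)

/-! ### Moments of sums of independent variables -/

/-- For `|t| ≤ 1` one has `e^t ≤ 1 + t + t²`. The linear term integrates to zero, and `1 + x ≤ e^x`
concludes. -/
theorem integral_exp_mul_le {Y : ℝ → ℝ} (hY : Measurable Y) {M V a : ℝ}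
    (hM : ∀ᵐ x ∂P, |Y x| ≤ M) (h0 : ∫ x, Y x ∂P = 0) (hV : ∫ x, Y x ^ 2 ∂P ≤ V)
    (ha : |a| * M ≤ 1) :
    ∫ x, Real.exp (a * Y x) ∂P ≤ Real.exp (a ^ 2 * V) := by
  have hle : ∀ᵐ x ∂P, |a * Y x| ≤ 1 := by
    filter_upwards [hM] with x hx
    rw [abs_mul]
    exact (mul_le_mul_of_nonneg_left hx (abs_nonneg a)).trans ha
  have hYi : Integrable Y P := Integrable.of_bound hY.aestronglyMeasurable M hM
  have hY2 : Integrable (fun x => Y x ^ 2) P := by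
    refine Integrable.of_bound (hY.pow_const 2).aestronglyMeasurable (M ^ 2) ?_
    filter_upwards [hM] with x hx
    rw [Real.norm_eq_abs, abs_pow]
    exact pow_le_pow_left₀ (abs_nonneg _) hx 2
  have hexp : Integrable (fun x => Real.exp (a * Y x)) P := by
    refine Integrable.of_bound (by fun_prop) (Real.exp 1) ?_
    filter_upwards [hle] with x hx
    rw [Real.norm_eq_abs, Real.abs_exp]
    exact Real.exp_le_exp.2 ((le_abs_self _).trans hx)
  have hlin : Integrable (fun x => 1 + a * Y x) P := (integrable_const 1).add (hYi.const_mul a)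
  calc ∫ x, Real.exp (a * Y x) ∂P ≤ ∫ x, (1 + a * Y x + a ^ 2 * Y x ^ 2) ∂P := by
        refine integral_mono_ae hexp
          (hlin.add (hY2.const_mul _)) ?_
        filter_upwards [hle] with x hx
        have := (abs_le.1 (Real.abs_exp_sub_one_sub_id_le hx)).2
        rw [mul_pow] at this
        linarith
    _ = 1 + a ^ 2 * ∫ x, Y x ^ 2 ∂P := by
        rw [integral_add hlin (hY2.const_mul _),
          integral_add (integrable_const 1) (hYi.const_mul a), integral_const_mul,
          integral_const_mul, h0]
        simp
    _ ≤ 1 + a ^ 2 * V := by gcongr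
    _ ≤ _ := by linarith [Real.add_one_le_exp (a ^ 2 * V)]

theorem lintegral_exp_sum_le {n : ℕ} (T : Finset (Fin n)) {Y : ℝ → ℝ} (hY : Measurable Y)
    {M V a : ℝ} (hM : ∀ᵐ x ∂P, |Y x| ≤ M) (h0 : ∫ x, Y x ∂P = 0) (hV : ∫ x, Y x ^ 2 ∂P ≤ V)
    (ha : |a| * M ≤ 1) :
    ∫⁻ X, ENNReal.ofReal (Real.exp (a * ∑ i ∈ T, Y (X i))) ∂(Measure.pi fun _ : Fin n => P) ≤
      ENNReal.ofReal (Real.exp (T.card * (a ^ 2 * V))) := by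
  -- Coordinates outside `T` get the factor 1, so that independence applies to a product over all of
  -- `Fin n`. Below, `T` is the whole training sample or the set of learning indices.
  have hprod : ∀ X : Fin n → ℝ, Real.exp (a * ∑ i ∈ T, Y (X i)) =
      ∏ i, (if i ∈ T then Real.exp (a * Y (X i)) else 1) := by
    intro X
    rw [Finset.mul_sum, Real.exp_sum, Finset.prod_ite_mem, Finset.univ_inter]
  have hbd : ∀ᵐ X ∂(Measure.pi fun _ : Fin n => P), ∀ i, |Y (X i)| ≤ M := by
    rw [ae_all_iff]
    exact fun i => (measurePreserving_eval (fun _ : Fin n => P) i).quasiMeasurePreserving.ae hM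
  have hint : Integrable (fun X : Fin n → ℝ => Real.exp (a * ∑ i ∈ T, Y (X i)))
      (Measure.pi fun _ : Fin n => P) := by
    have hmeas : Measurable fun X : Fin n → ℝ => Real.exp (a * ∑ i ∈ T, Y (X i)) := by fun_prop
    refine Integrable.of_bound hmeas.aestronglyMeasurable (Real.exp (|a| * ∑ i ∈ T, M)) ?_
    filter_upwards [hbd] with X hX
    rw [Real.norm_eq_abs, Real.abs_exp, Real.exp_le_exp]
    refine (le_abs_self _).trans ?_
    rw [abs_mul]
    gcongr
    exact (Finset.abs_sum_le_sum_abs _ _).trans (Finset.sum_le_sum fun i _ => hX i)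
  rw [← ofReal_integral_eq_lintegral_ofReal hint (ae_of_all _ fun _ => (Real.exp_pos _).le)]
  refine ENNReal.ofReal_le_ofReal ?_
  simp_rw [hprod]
  rw [integral_fintype_prod_eq_prod (fun (i : Fin n) (x : ℝ) =>
    if i ∈ T then Real.exp (a * Y x) else 1)]
  have hfac : ∀ i : Fin n, ∫ x, (if i ∈ T then Real.exp (a * Y x) else 1) ∂P =
      if i ∈ T then ∫ x, Real.exp (a * Y x) ∂P else 1 := by
    intro i
    split_ifs <;> simp
  simp_rw [hfac]
  rw [Finset.prod_ite_mem, Finset.univ_inter, Finset.prod_const, Real.exp_nat_mul]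
  exact pow_le_pow_left₀ (integral_nonneg fun _ => (Real.exp_pos _).le)
    (integral_exp_mul_le hY hM h0 hV ha) _

theorem measurable_empCoeff {m : ℕ} {e : ℝ → ℝ} (he : Measurable e) :
    Measurable fun D : Fin m → ℝ => empCoeff D e := by
  unfold empCoeff
  fun_prop

/-- The variance of an empirical coefficient. -/
theorem lintegral_empCoeff_sub_sq_le {m : ℕ} (hm : 0 < m) {e : ℝ → ℝ} {V : ℝ}
    (he : MemLp e 2 P) (hV : ∫ x, e x ^ 2 ∂P ≤ V) :
    ∫⁻ D, ENNReal.ofReal ((empCoeff D e - ∫ x, e x ∂P) ^ 2) ∂(Measure.pi fun _ : Fin m => P) ≤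
      ENNReal.ofReal (V / m) := by
  have hm' : (0 : ℝ) < m := by exact_mod_cast hm
  have hmp : ∀ i : Fin m, MemLp (fun D : Fin m → ℝ => e (D i)) 2 (Measure.pi fun _ : Fin m => P) :=
    fun i => he.comp_measurePreserving (measurePreserving_eval (fun _ : Fin m => P) i)
  have hZ : MemLp (fun D : Fin m → ℝ => empCoeff D e) 2 (Measure.pi fun _ : Fin m => P) := by
    unfold empCoeff
    exact (memLp_finsetSum _ fun i _ => hmp i).const_mul _
  have hmean : ∫ D, empCoeff D e ∂(Measure.pi fun _ : Fin m => P) = ∫ x, e x ∂P := by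
    unfold empCoeff
    rw [integral_const_mul, integral_finsetSum _ fun i _ => (hmp i).integrable one_le_two]
    have : ∀ i : Fin m, ∫ D : Fin m → ℝ, e (D i) ∂(Measure.pi fun _ : Fin m => P) =
        ∫ x, e x ∂P := fun i => integral_comp_eval (μ := fun _ : Fin m => P) he.1
    simp only [this, Finset.sum_const, Finset.card_univ, Fintype.card_fin, nsmul_eq_mul]
    field_simp
  have hvar : ProbabilityTheory.variance (fun D : Fin m → ℝ => empCoeff D e)
      (Measure.pi fun _ : Fin m => P) ≤ V / m := by
    unfold empCoeff
    rw [ProbabilityTheory.variance_const_mul]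
    have h := ProbabilityTheory.variance_sum_pi (μ := fun _ : Fin m => P) (X := fun _ => e)
      (fun _ => he)
    have hfun : (fun D : Fin m → ℝ => ∑ i, e (D i)) = ∑ i, fun D : Fin m → ℝ => e (D i) := by
      ext D; simp
    rw [hfun, h]
    simp only [Finset.sum_const, Finset.card_univ, Fintype.card_fin, nsmul_eq_mul]
    have h2 : ProbabilityTheory.variance e P ≤ V :=
      (ProbabilityTheory.variance_le_expectation_sq he.1).trans hV
    calc (1 / (m : ℝ)) ^ 2 * (m * ProbabilityTheory.variance e P)
        = ProbabilityTheory.variance e P / m := by field_simp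
      _ ≤ V / m := by gcongr
  have h := ENNReal.ofReal_le_ofReal hvar
  rw [ProbabilityTheory.ofReal_variance hZ, ProbabilityTheory.evariance, hmean] at h
  refine le_trans (le_of_eq ?_) h
  refine lintegral_congr fun D => ?_
  rw [← ofReal_norm, ← ENNReal.ofReal_pow (norm_nonneg _), Real.norm_eq_abs, sq_abs]

/-- With `x = θ(z - t)/2` and `θt ≥ 1`, `z ≤ t(1 + 2x) ≤ 2t(1 + x) ≤ 2t e^x`. A truncated second
moment is thereby bounded by an exponential moment, with no integration of tails. -/
theorem sq_le_exp_of_le {t θ z : ℝ} (ht : 0 < t) (hθ : 1 ≤ θ * t) (hz : t ≤ z) :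
    z ^ 2 ≤ 4 * t ^ 2 * Real.exp (θ * (z - t)) := by
  have h1 : z ≤ 2 * t * Real.exp (θ * (z - t) / 2) := by
    have h2 := Real.add_one_le_exp (θ * (z - t) / 2)
    have h3 : z - t ≤ t * (θ * (z - t)) := by nlinarith [mul_nonneg (sub_nonneg.2 hz) (sub_nonneg.2 hθ)]
    nlinarith
  calc z ^ 2 ≤ (2 * t * Real.exp (θ * (z - t) / 2)) ^ 2 :=
        pow_le_pow_left₀ (ht.le.trans hz) h1 2
    _ = 4 * t ^ 2 * (Real.exp (θ * (z - t) / 2)) ^ 2 := by ring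
    _ = _ := by rw [← Real.exp_nat_mul]; congr 2; push_cast; ring

/-- A Bernstein type bound for the truncated second moment of an empirical coefficient. -/
theorem lintegral_empCoeff_sub_sq_tail_le {m : ℕ} (hm : 0 < m) {e : ℝ → ℝ} (he : Measurable e)
    {V M t : ℝ} (hM0 : 0 ≤ M) (hV0 : 0 < V) (ht : 0 < t)
    (hM : ∀ᵐ x ∂P, |e x - ∫ y, e y ∂P| ≤ M) (hV : ∫ x, e x ^ 2 ∂P ≤ V)
    (hlarge : 2 * V + M * t ≤ m * t ^ 2) :
    ∫⁻ D, ENNReal.ofReal (if t ≤ |empCoeff D e - ∫ x, e x ∂P| then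
        |empCoeff D e - ∫ x, e x ∂P| ^ 2 else 0) ∂(Measure.pi fun _ : Fin m => P) ≤
      ENNReal.ofReal (8 * t ^ 2 * Real.exp (-(m * t ^ 2 / (2 * (2 * V + M * t))))) := by
  have hm' : (0 : ℝ) < m := by exact_mod_cast hm
  set c := ∫ x, e x ∂P with hc
  set Y : ℝ → ℝ := fun x => e x - c with hYdef
  have hY : Measurable Y := he.sub_const c
  have hYi : Integrable Y P := Integrable.of_bound hY.aestronglyMeasurable M hM
  have hei : Integrable e P := by
    have := hYi.add (integrable_const c)
    refine this.congr (ae_of_all _ fun x => ?_)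
    simp [hYdef]
  have h0 : ∫ x, Y x ∂P = 0 := by
    rw [hYdef, integral_sub hei (integrable_const c)]
    simp [hc]
  have he2 : Integrable (fun x => e x ^ 2) P := by
    refine Integrable.of_bound (he.pow_const 2).aestronglyMeasurable ((M + |c|) ^ 2) ?_
    filter_upwards [hM] with x hx
    rw [Real.norm_eq_abs, abs_pow]
    refine pow_le_pow_left₀ (abs_nonneg _) ?_ 2
    calc |e x| = |(e x - c) + c| := by ring_nf
      _ ≤ |e x - c| + |c| := abs_add_le _ _
      _ ≤ _ := by linarith
  have hVY : ∫ x, Y x ^ 2 ∂P ≤ V := by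
    have : ∫ x, Y x ^ 2 ∂P = ∫ x, e x ^ 2 ∂P - c ^ 2 := by
      have h1 : ∀ x, Y x ^ 2 = e x ^ 2 - (2 * c) * e x + c ^ 2 := fun x => by simp [hYdef]; ring
      have h2 : Integrable (fun x => e x ^ 2 - (2 * c) * e x) P := he2.sub (hei.const_mul _)
      simp_rw [h1]
      rw [integral_add h2 (integrable_const _),
        integral_sub he2 (hei.const_mul _), integral_const_mul]
      simp [← hc]
      ring
    rw [this]
    nlinarith [sq_nonneg c]
  set b := 2 * V + M * t with hb
  have hbpos : 0 < b := by positivity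
  -- The exponential moment is taken at `θ/m = t/b`. This is admissible since `tM ≤ b`, and the
  -- quadratic term `m (t/b)² V` is at most `θt/2` since `2V ≤ b`, so half of the exponent `θt =
  -- mt²/b` survives.
  set θ : ℝ := m * t / b with hθ
  have hθt : 1 ≤ θ * t := by
    rw [hθ, div_mul_eq_mul_div, le_div_iff₀ hbpos]
    nlinarith
  have hZ : ∀ D : Fin m → ℝ, empCoeff D e - c = (1 / (m : ℝ)) * ∑ i, Y (D i) := by
    intro D
    simp only [empCoeff, hYdef, Finset.sum_sub_distrib, Finset.sum_const, Finset.card_univ,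
      Fintype.card_fin, nsmul_eq_mul]
    field_simp
  have hsmall : |t / b| * M ≤ 1 := by
    rw [abs_of_pos (by positivity), div_mul_eq_mul_div, div_le_one hbpos]
    nlinarith
  -- The two signs of `a` cover the two tails, which turns the factor 4 into 8.
  have hbound : ∀ a : ℝ, |a| = t / b →
      ∫⁻ D, ENNReal.ofReal (4 * t ^ 2 * Real.exp (-(θ * t)) *
        Real.exp (a * ∑ i, Y (D i))) ∂(Measure.pi fun _ : Fin m => P) ≤
      ENNReal.ofReal (4 * t ^ 2 * Real.exp (-(m * t ^ 2 / (2 * b)))) := by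
    intro a ha
    have hsm : |a| * M ≤ 1 := by
      rw [ha, ← abs_of_pos (by positivity : 0 < t / b)]; exact hsmall
    have h := lintegral_exp_sum_le (P := P) (Finset.univ : Finset (Fin m)) hY hM h0 hVY hsm
    have hnn : 0 ≤ 4 * t ^ 2 * Real.exp (-(θ * t)) := by positivity
    simp_rw [ENNReal.ofReal_mul hnn]
    rw [lintegral_const_mul _ (by fun_prop)]
    calc _ ≤ ENNReal.ofReal (4 * t ^ 2 * Real.exp (-(θ * t))) *
          ENNReal.ofReal (Real.exp ((Finset.univ : Finset (Fin m)).card * (a ^ 2 * V))) := by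
            gcongr
      _ = ENNReal.ofReal (4 * t ^ 2 * Real.exp (-(θ * t) + m * (a ^ 2 * V))) := by
            rw [← ENNReal.ofReal_mul hnn, mul_assoc, ← Real.exp_add]
            simp
      _ ≤ _ := by
            refine ENNReal.ofReal_le_ofReal ?_
            gcongr
            rw [← sq_abs a, ha, hθ]
            have h1 : V / b ≤ 1 / 2 := by
              rw [div_le_div_iff₀ hbpos two_pos]
              nlinarith [mul_nonneg hM0 ht.le]
            have h2 : (m : ℝ) * ((t / b) ^ 2 * V) = (m * t ^ 2 / b) * (V / b) := by
              field_simp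
            have h3 : (m : ℝ) * t / b * t = m * t ^ 2 / b := by ring
            have h4 : (m : ℝ) * t ^ 2 / (2 * b) = (m * t ^ 2 / b) * (1 / 2) := by
              field_simp
            rw [h2, h3, h4]
            have h5 : 0 ≤ (m : ℝ) * t ^ 2 / b := by positivity
            nlinarith
  have hpt : ∀ D : Fin m → ℝ,
      ENNReal.ofReal (if t ≤ |empCoeff D e - c| then |empCoeff D e - c| ^ 2 else 0) ≤
        ENNReal.ofReal (4 * t ^ 2 * Real.exp (-(θ * t)) *
          Real.exp ((t / b) * ∑ i, Y (D i))) +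
        ENNReal.ofReal (4 * t ^ 2 * Real.exp (-(θ * t)) *
          Real.exp ((-(t / b)) * ∑ i, Y (D i))) := by
    intro D
    rw [← ENNReal.ofReal_add (by positivity) (by positivity)]
    refine ENNReal.ofReal_le_ofReal ?_
    split_ifs with h
    · have h1 := sq_le_exp_of_le ht hθt h
      have h2 : θ * (|empCoeff D e - c| - t) = -(θ * t) + θ * |empCoeff D e - c| := by ring
      rw [h2, Real.exp_add, ← mul_assoc] at h1
      refine h1.trans ?_
      rw [← mul_add]
      gcongr
      have h3 : θ * (empCoeff D e - c) = (t / b) * ∑ i, Y (D i) := by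
        rw [hZ, hθ]; field_simp
      rcases abs_cases (empCoeff D e - c) with ⟨h4, _⟩ | ⟨h4, _⟩
      · rw [h4, h3]
        linarith [Real.exp_pos (-(t / b) * ∑ i, Y (D i))]
      · rw [h4, mul_neg, h3, ← neg_mul]
        linarith [Real.exp_pos ((t / b) * ∑ i, Y (D i))]
    · positivity
  refine (lintegral_mono hpt).trans ?_
  rw [lintegral_add_left (by fun_prop)]
  refine (add_le_add (hbound _ (abs_of_pos (by positivity)))
    (hbound _ (by rw [abs_neg]; exact abs_of_pos (by positivity)))).trans ?_
  rw [← ENNReal.ofReal_add (by positivity) (by positivity)]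
  refine ENNReal.ofReal_le_ofReal (le_of_eq ?_)
  ring

end Pi

/-! ### Exponential weights -/

/-- Replaces a deviation by its exponential moment; when that moment is at most 1 the cost is `1/a`.
-/
theorem le_exp_mul_div {a : ℝ} (ha : 0 < a) (x : ℝ) : x ≤ Real.exp (a * x) / a := by
  rw [le_div_iff₀ ha]
  linarith [Real.add_one_le_exp (a * x)]

/-- The deterministic inequality behind the aggregation bound: `A` are the empirical risks, `A₀` is
the empirical risk of the target and `r` are the excess risks. -/
theorem sum_expWeight_mul_le {Λ : Finset ℕ} {v : ℕ} (hv : v ∈ Λ) (A r : ℕ → ℝ) (A₀ : ℝ) {l a : ℝ}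
    (hl : 0 < l) (ha : 0 < a) :
    ∑ u ∈ Λ, Real.exp (-l * A u) / (∑ γ ∈ Λ, Real.exp (-l * A γ)) * r u ≤
      3 * r v + 2 * Λ.card / l + 2 / a *
        (∑ u ∈ Λ, Real.exp (a * (r u / 2 - (A u - A₀))) +
          Real.exp (a * ((A v - A₀) - 3 / 2 * r v))) := by
  set S := ∑ γ ∈ Λ, Real.exp (-l * A γ) with hS
  have hvS : Real.exp (-l * A v) ≤ S :=
    Finset.single_le_sum (f := fun γ => Real.exp (-l * A γ)) (fun _ _ => (Real.exp_pos _).le) hv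
  have hSpos : 0 < S := (Real.exp_pos _).trans_le hvS
  have hw1 : ∑ u ∈ Λ, Real.exp (-l * A u) / S = 1 := by
    rw [← Finset.sum_div, ← hS, div_self hSpos.ne']
  -- The excess risk is split as `r u = 2 (r u / 2 - (A u - A₀)) + 2 (A u - A v) + 2 (A v - A₀)`.
  -- The first part is a deviation. The second costs at most `2/l` after weighting, since the weight
  -- is at most `e^{-l(A u - A v)}` and `x e^{-x} ≤ 1`. The third is averaged with total weight 1.
  have hterm : ∀ u ∈ Λ, Real.exp (-l * A u) / S * r u ≤
      2 / a * Real.exp (a * (r u / 2 - (A u - A₀))) + 2 / l +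
        Real.exp (-l * A u) / S * (2 * (A v - A₀)) := by
    intro u hu
    set w := Real.exp (-l * A u) / S with hw
    have hw0 : 0 ≤ w := by positivity
    have hwle : w ≤ 1 := by
      rw [hw, div_le_one hSpos]
      exact Finset.single_le_sum (f := fun γ => Real.exp (-l * A γ))
        (fun _ _ => (Real.exp_pos _).le) hu
    have h1 : w * (r u / 2 - (A u - A₀)) ≤ Real.exp (a * (r u / 2 - (A u - A₀))) / a := by
      have h := le_exp_mul_div ha (r u / 2 - (A u - A₀))
      have hpos : 0 ≤ Real.exp (a * (r u / 2 - (A u - A₀))) / a := by positivity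
      nlinarith
    have h2 : w * (A u - A v) ≤ 1 / l := by
      have hexp : w ≤ Real.exp (-(l * (A u - A v))) := by
        rw [hw, div_le_iff₀ hSpos]
        calc Real.exp (-l * A u) = Real.exp (-(l * (A u - A v))) * Real.exp (-l * A v) := by
              rw [← Real.exp_add]; ring_nf
          _ ≤ _ := by gcongr
      rw [le_div_iff₀ hl]
      rcases le_or_gt (A u - A v) 0 with h | h
      · nlinarith [mul_nonneg hw0 hl.le]
      · have h3 : l * (A u - A v) ≤ Real.exp (l * (A u - A v)) := by
          linarith [Real.add_one_le_exp (l * (A u - A v))]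
        calc w * (A u - A v) * l = w * (l * (A u - A v)) := by ring
          _ ≤ Real.exp (-(l * (A u - A v))) * Real.exp (l * (A u - A v)) := by gcongr
          _ = 1 := by rw [← Real.exp_add]; simp
    have h4 : w * r u = 2 * (w * (r u / 2 - (A u - A₀))) + 2 * (w * (A u - A v)) +
        w * (2 * (A v - A₀)) := by ring
    rw [h4]
    have h5 : 2 / a * Real.exp (a * (r u / 2 - (A u - A₀))) =
        2 * (Real.exp (a * (r u / 2 - (A u - A₀))) / a) := by ring
    have h6 : 2 / l = 2 * (1 / l) := by ring
    rw [h5, h6]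
    linarith
  refine (Finset.sum_le_sum hterm).trans ?_
  rw [Finset.sum_add_distrib, Finset.sum_add_distrib, ← Finset.mul_sum, ← Finset.sum_mul, hw1,
    Finset.sum_const, nsmul_eq_mul]
  have h := le_exp_mul_div ha ((A v - A₀) - 3 / 2 * r v)
  have h7 : 2 / a * Real.exp (a * ((A v - A₀) - 3 / 2 * r v)) =
      2 * (Real.exp (a * ((A v - A₀) - 3 / 2 * r v)) / a) := by ring
  rw [mul_add, h7]
  have h8 : (Λ.card : ℝ) * (2 / l) = 2 * Λ.card / l := by ring
  linarith

/-! ### Concentration on the learning sample, clipping, and the oracle inequality. -/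

section Learn

variable {B : ℝ} {f : ℝ → ℝ}

theorem integrable_unitMeasure_of_mem_Icc {g : ℝ → ℝ} (hg : Measurable g)
    (h : ∀ x, g x ∈ Set.Icc (-B) B) {μ : Measure ℝ} [IsFiniteMeasure μ] : Integrable g μ :=
  Integrable.of_bound hg.aestronglyMeasurable B (ae_of_all _ fun x => abs_le.2 (h x))

theorem integrable_sq_of_mem_Icc {g : ℝ → ℝ} (hg : Measurable g)
    (h : ∀ x, g x ∈ Set.Icc (-B) B) {μ : Measure ℝ} [IsFiniteMeasure μ] :
    Integrable (fun x => g x ^ 2) μ := by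
  refine Integrable.of_bound (hg.pow_const 2).aestronglyMeasurable (B ^ 2) (ae_of_all _ fun x => ?_)
  rw [Real.norm_eq_abs, abs_pow]
  exact pow_le_pow_left₀ (abs_nonneg _) (abs_le.2 (h x)) 2

theorem card_learn_filter {n : ℕ} (hn : learnSize n ≤ n) :
    (Finset.univ.filter (fun i : Fin n => trainSize n ≤ (i : ℕ))).card = learnSize n := by
  have h := Finset.card_filter_add_card_filter_not (s := (Finset.univ : Finset (Fin n)))
    (fun i : Fin n => (i : ℕ) < trainSize n)
  have h2 : (Finset.univ.filter (fun i : Fin n => (i : ℕ) < trainSize n)).card = trainSize n := by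
    rw [Fin.card_filter_val_lt]
    simp [trainSize]
  simp only [not_lt, Finset.card_univ, Fintype.card_fin, h2] at h
  unfold trainSize at h ⊢
  omega

/-- The empirical excess risk is the excess risk plus a centered empirical mean. -/
theorem learnRisk_sub_learnRisk (hf : IsBoundedDensity B f) (hfI : ∀ x, f x ∈ Set.Icc 0 B)
    {n : ℕ} (hn : learnSize n ≤ n) (hl : 0 < learnSize n) {g : ℝ → ℝ} (hg : Measurable g)
    (hgI : ∀ x, g x ∈ Set.Icc 0 B) (X : Fin n → ℝ) :
    learnRisk X g - learnRisk X f = ∫ x, (g x - f x) ^ 2 ∂unitMeasure -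
      2 / (learnSize n : ℝ) *
        ∑ i ∈ Finset.univ.filter (fun i : Fin n => trainSize n ≤ (i : ℕ)),
          ((g (X i) - f (X i)) - ∫ x, (g x - f x) ∂densityLaw f) := by
  have hl' : (0 : ℝ) < learnSize n := by exact_mod_cast hl
  have hd : ∀ x, g x - f x ∈ Set.Icc (-B) B := fun x =>
    ⟨by linarith [(hgI x).1, (hfI x).2], by linarith [(hgI x).2, (hfI x).1]⟩
  have hB : 0 ≤ B := (hfI 0).1.trans (hfI 0).2
  have hIcc : ∀ {h : ℝ → ℝ}, (∀ x, h x ∈ Set.Icc 0 B) → ∀ x, h x ∈ Set.Icc (-B) B :=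
    fun h x => ⟨by linarith [(h x).1], (h x).2⟩
  have hg2 := integrable_sq_of_mem_Icc hg (hIcc hgI) (μ := unitMeasure)
  have hf2 := integrable_sq_of_mem_Icc hf.measurable (hIcc hfI) (μ := unitMeasure)
  have hd2 := integrable_sq_of_mem_Icc (hg.sub hf.measurable) hd (μ := unitMeasure)
  have hgf : Integrable (fun x => g x ^ 2 - f x ^ 2) unitMeasure := hg2.sub hf2
  -- In the expansion of the square, the cross term `∫ (g - f) f` is an expectation under the
  -- density `f`, so the mean excess loss is exactly the squared distance.
  have hr : ∫ x, (g x - f x) ^ 2 ∂unitMeasure = ∫ x, g x ^ 2 ∂unitMeasure -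
      ∫ x, f x ^ 2 ∂unitMeasure - 2 * ∫ x, (g x - f x) ∂densityLaw f := by
    rw [integral_densityLaw hf, coeff, ← integral_const_mul, ← integral_sub hg2 hf2,
      ← integral_sub hgf]
    · refine integral_congr_ae (ae_of_all _ fun x => ?_)
      simp only
      ring
    · have : Integrable (fun x => g x ^ 2 - f x ^ 2 - (g x - f x) ^ 2) unitMeasure :=
        hgf.sub hd2
      refine this.congr (ae_of_all _ fun x => ?_)
      simp only
      ring
  rw [hr]
  unfold learnRisk quadLoss
  rw [← mul_sub, ← Finset.sum_sub_distrib]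
  have hs : ∀ c : ℝ, ∑ i ∈ Finset.univ.filter (fun i : Fin n => trainSize n ≤ (i : ℕ)), c =
      learnSize n * c := fun c => by
    rw [Finset.sum_const, card_learn_filter hn, nsmul_eq_mul]
  simp only [Finset.sum_sub_distrib, hs, ← Finset.mul_sum]
  field_simp
  ring

/-- The exponential moment bound for the deviation of the empirical excess risk. -/
theorem lintegral_exp_learnRisk_le (hB : 0 < B) (hf : IsBoundedDensity B f)
    (hfI : ∀ x, f x ∈ Set.Icc 0 B) {n : ℕ} (hn : learnSize n ≤ n) (hl : 0 < learnSize n)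
    {g : ℝ → ℝ} (hg : Measurable g) (hgI : ∀ x, g x ∈ Set.Icc 0 B) {σ : ℝ} (hσ : |σ| = 1) :
    ∫⁻ X, ENNReal.ofReal (Real.exp (learnSize n / (8 * B) *
        (σ * (∫ x, (g x - f x) ^ 2 ∂unitMeasure - (learnRisk X g - learnRisk X f)) -
          (∫ x, (g x - f x) ^ 2 ∂unitMeasure) / 2)))
        ∂(Measure.pi fun _ : Fin n => densityLaw f) ≤ 1 := by
  have := hf.isProbabilityMeasure
  have hl' : (0 : ℝ) < learnSize n := by exact_mod_cast hl
  have hd : ∀ x, g x - f x ∈ Set.Icc (-B) B := fun x =>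
    ⟨by linarith [(hgI x).1, (hfI x).2], by linarith [(hgI x).2, (hfI x).1]⟩
  set r := ∫ x, (g x - f x) ^ 2 ∂unitMeasure with hr
  set c := ∫ x, (g x - f x) ∂densityLaw f with hc
  set W : ℝ → ℝ := fun x => (g x - f x) - c with hW
  have hdm : Measurable fun x => g x - f x := hg.sub hf.measurable
  have hWm : Measurable W := hdm.sub_const c
  have hdi : Integrable (fun x => g x - f x) (densityLaw f) :=
    integrable_unitMeasure_of_mem_Icc hdm hd
  have hd2 : Integrable (fun x => (g x - f x) ^ 2) (densityLaw f) :=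
    integrable_sq_of_mem_Icc hdm hd
  have hcB : |c| ≤ B := by
    have := norm_integral_le_of_norm_le_const (μ := densityLaw f) (f := fun x => g x - f x) (C := B)
      (ae_of_all _ fun x => abs_le.2 (hd x))
    simpa using this
  have hWB : ∀ᵐ x ∂densityLaw f, |W x| ≤ 2 * B := ae_of_all _ fun x =>
    (abs_sub _ _).trans (by linarith [abs_le.2 (hd x)])
  have hW0 : ∫ x, W x ∂densityLaw f = 0 := by
    rw [hW, integral_sub hdi (integrable_const c)]
    simp [hc]
  have hr0 : 0 ≤ r := integral_nonneg fun x => sq_nonneg _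
  -- This is where `f ≤ B` enters: the variance is controlled by the excess risk itself, which gives
  -- the price `1/l` instead of `1/√l`.
  have hrB : ∫ x, (g x - f x) ^ 2 ∂densityLaw f ≤ B * r := by
    rw [integral_densityLaw hf, coeff, hr, ← integral_const_mul]
    have hd2' : Integrable (fun x => (g x - f x) ^ 2) unitMeasure := integrable_sq_of_mem_Icc hdm hd
    refine integral_mono_of_nonneg (ae_of_all _ fun x => mul_nonneg (hfI x).1 (sq_nonneg _))
      (hd2'.const_mul B) (ae_of_all _ fun x => ?_)
    exact mul_le_mul_of_nonneg_right (hfI x).2 (sq_nonneg _)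
  have hWV : ∫ x, W x ^ 2 ∂densityLaw f ≤ B * r := by
    have h1 : ∀ x, W x ^ 2 = (g x - f x) ^ 2 - (2 * c) * (g x - f x) + c ^ 2 := fun x => by
      simp only [hW]; ring
    have h2 : Integrable (fun x => (g x - f x) ^ 2 - (2 * c) * (g x - f x)) (densityLaw f) :=
      hd2.sub (hdi.const_mul _)
    simp_rw [h1]
    rw [integral_add h2 (integrable_const _), integral_sub hd2 (hdi.const_mul _),
      integral_const_mul, ← hc]
    simp only [integral_const, probReal_univ, smul_eq_mul, one_mul]
    nlinarith [sq_nonneg c]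
  -- At `a = σ/(4B)` the condition reads `|a| · 2B = 1/2 ≤ 1`, and the variance term `l a² B r = l r
  -- / (16B)` is exactly cancelled by the `-r/2` of the statement.
  have hmain := lintegral_exp_sum_le (P := densityLaw f)
    (Finset.univ.filter (fun i : Fin n => trainSize n ≤ (i : ℕ))) hWm hWB hW0 hWV
    (a := σ / (4 * B)) (by
      rw [abs_div, hσ, abs_of_pos (by positivity)]
      rw [div_mul_eq_mul_div, div_le_one (by positivity)]
      linarith)
  rw [card_learn_filter hn] at hmain
  have hσ2 : σ ^ 2 = 1 := by rw [← sq_abs, hσ, one_pow]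
  have hpt : ∀ X : Fin n → ℝ, Real.exp (learnSize n / (8 * B) *
        (σ * (r - (learnRisk X g - learnRisk X f)) - r / 2)) =
      Real.exp (-(learnSize n * ((σ / (4 * B)) ^ 2 * (B * r)))) * Real.exp (σ / (4 * B) *
        ∑ i ∈ Finset.univ.filter (fun i : Fin n => trainSize n ≤ (i : ℕ)), W (X i)) := by
    intro X
    rw [learnRisk_sub_learnRisk hf hfI hn hl hg hgI X, ← Real.exp_add, div_pow, hσ2]
    congr 1
    simp only [hW]
    field_simp
    ring
  simp_rw [hpt, ENNReal.ofReal_mul (Real.exp_pos _).le]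
  rw [lintegral_const_mul _ (by fun_prop)]
  calc _ ≤ ENNReal.ofReal (Real.exp (-(learnSize n * ((σ / (4 * B)) ^ 2 * (B * r))))) *
        ENNReal.ofReal (Real.exp (learnSize n * ((σ / (4 * B)) ^ 2 * (B * r)))) := by gcongr
    _ = 1 := by
      rw [← ENNReal.ofReal_mul (Real.exp_pos _).le, ← Real.exp_add]
      simp

theorem measurable_learnRisk {n : ℕ} {g : ℝ → ℝ} (hg : Measurable g) :
    Measurable fun X : Fin n → ℝ => learnRisk X g := by
  unfold learnRisk quadLoss
  fun_prop

/-- Aggregation of fixed functions with exponential weights. -/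
theorem lintegral_expWeight_aggregate_le (hB : 0 < B) (hf : IsBoundedDensity B f)
    (hfI : ∀ x, f x ∈ Set.Icc 0 B) {n : ℕ} (hn : learnSize n ≤ n) (hl : 0 < learnSize n)
    {Λ : Finset ℕ} {v : ℕ} (hv : v ∈ Λ) {g : ℕ → ℝ → ℝ} (hg : ∀ u, Measurable (g u))
    (hgI : ∀ u x, g u x ∈ Set.Icc 0 B) :
    ∫⁻ X, (∫⁻ x, ENNReal.ofReal
        ((∑ u ∈ Λ, Real.exp (-(learnSize n : ℝ) * learnRisk X (g u)) /
          (∑ γ ∈ Λ, Real.exp (-(learnSize n : ℝ) * learnRisk X (g γ))) * g u x - f x) ^ 2)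
        ∂unitMeasure) ∂(Measure.pi fun _ : Fin n => densityLaw f) ≤
      3 * (∫⁻ x, ENNReal.ofReal ((g v x - f x) ^ 2) ∂unitMeasure) +
        ENNReal.ofReal ((2 * Λ.card + 16 * B * (Λ.card + 1)) / learnSize n) := by
  have := hf.isProbabilityMeasure
  have hl' : (0 : ℝ) < learnSize n := by exact_mod_cast hl
  set l : ℝ := (learnSize n : ℝ) with hldef
  set a : ℝ := l / (8 * B) with ha
  have hapos : 0 < a := by positivity
  have hd : ∀ u x, g u x - f x ∈ Set.Icc (-B) B := fun u x =>
    ⟨by linarith [(hgI u x).1, (hfI x).2], by linarith [(hgI u x).2, (hfI x).1]⟩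
  have hd2 : ∀ u, Integrable (fun x => (g u x - f x) ^ 2) unitMeasure := fun u =>
    integrable_sq_of_mem_Icc ((hg u).sub hf.measurable) (hd u)
  set r : ℕ → ℝ := fun u => ∫ x, (g u x - f x) ^ 2 ∂unitMeasure with hr
  -- The weights form a probability vector, so convexity of the square moves them outside the loss.
  have hinner : ∀ X : Fin n → ℝ, (∫⁻ x, ENNReal.ofReal
        ((∑ u ∈ Λ, Real.exp (-l * learnRisk X (g u)) /
          (∑ γ ∈ Λ, Real.exp (-l * learnRisk X (g γ))) * g u x - f x) ^ 2)
        ∂unitMeasure) ≤ ENNReal.ofReal (∑ u ∈ Λ, Real.exp (-l * learnRisk X (g u)) /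
          (∑ γ ∈ Λ, Real.exp (-l * learnRisk X (g γ))) * r u) := by
    intro X
    set w : ℕ → ℝ := fun u => Real.exp (-l * learnRisk X (g u)) /
          (∑ γ ∈ Λ, Real.exp (-l * learnRisk X (g γ))) with hw
    have hSpos : 0 < ∑ γ ∈ Λ, Real.exp (-l * learnRisk X (g γ)) :=
      Finset.sum_pos (fun _ _ => Real.exp_pos _) ⟨v, hv⟩
    have hw0 : ∀ u ∈ Λ, 0 ≤ w u := fun u _ => by positivity
    have hw1 : ∑ u ∈ Λ, w u = 1 := by
      rw [hw, ← Finset.sum_div, div_self hSpos.ne']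
    calc _ ≤ ∫⁻ x, ENNReal.ofReal (∑ u ∈ Λ, w u * (g u x - f x) ^ 2) ∂unitMeasure := by
          refine lintegral_mono fun x => ENNReal.ofReal_le_ofReal ?_
          have h1 : ∑ u ∈ Λ, w u * g u x - f x = ∑ u ∈ Λ, w u * (g u x - f x) := by
            simp_rw [mul_sub]
            rw [Finset.sum_sub_distrib, ← Finset.sum_mul, hw1, one_mul]
          change (∑ u ∈ Λ, w u * g u x - f x) ^ 2 ≤ _
          rw [h1]
          exact Real.pow_arith_mean_le_arith_mean_pow_of_even Λ w _ hw0 hw1 even_two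
      _ = ENNReal.ofReal (∫ x, ∑ u ∈ Λ, w u * (g u x - f x) ^ 2 ∂unitMeasure) := by
          rw [ofReal_integral_eq_lintegral_ofReal]
          · exact integrable_finsetSum _ fun u _ => (hd2 u).const_mul _
          · exact ae_of_all _ fun x => Finset.sum_nonneg fun u hu =>
              mul_nonneg (hw0 u hu) (sq_nonneg _)
      _ = _ := by
          rw [integral_finsetSum _ fun u _ => (hd2 u).const_mul _]
          simp_rw [integral_const_mul]
          rfl
  have hr0 : ∀ u, 0 ≤ r u := fun u => integral_nonneg fun x => sq_nonneg _
  -- The sign `1` handles `r u / 2 - (A u - A₀)` for every index, the sign `-1` handles `(A v - A₀)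
  -- - 3/2 r v` for the reference index.
  have hpt : ∀ X : Fin n → ℝ, ENNReal.ofReal (∑ u ∈ Λ, Real.exp (-l * learnRisk X (g u)) /
          (∑ γ ∈ Λ, Real.exp (-l * learnRisk X (g γ))) * r u) ≤
      ENNReal.ofReal (3 * r v + 2 * Λ.card / l) + ENNReal.ofReal (2 / a) *
        (∑ u ∈ Λ, ENNReal.ofReal (Real.exp (a *
            (1 * (r u - (learnRisk X (g u) - learnRisk X f)) - r u / 2))) +
          ENNReal.ofReal (Real.exp (a *
            ((-1) * (r v - (learnRisk X (g v) - learnRisk X f)) - r v / 2)))) := by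
    intro X
    have h := sum_expWeight_mul_le hv (fun u => learnRisk X (g u)) r (learnRisk X f) hl' hapos
    rw [← ENNReal.ofReal_sum_of_nonneg fun _ _ => (Real.exp_pos _).le,
      ← ENNReal.ofReal_add (Finset.sum_nonneg fun _ _ => (Real.exp_pos _).le) (Real.exp_pos _).le,
      ← ENNReal.ofReal_mul (by positivity),
      ← ENNReal.ofReal_add (by have := hr0 v; positivity) (by positivity)]
    refine ENNReal.ofReal_le_ofReal (h.trans (le_of_eq ?_))
    congr 3
    · refine Finset.sum_congr rfl fun u _ => ?_
      congr 2; ring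
    · congr 1; ring
  have hme : ∀ (u : ℕ) (σ : ℝ), Measurable fun X : Fin n → ℝ => ENNReal.ofReal (Real.exp (a *
            (σ * (r u - (learnRisk X (g u) - learnRisk X f)) - r u / 2))) := by
    intro u σ
    have h1 := measurable_learnRisk (n := n) (hg u)
    have h2 := measurable_learnRisk (n := n) hf.measurable
    fun_prop
  refine (lintegral_mono fun X => (hinner X).trans (hpt X)).trans ?_
  rw [lintegral_add_left measurable_const, lintegral_const, measure_univ, lintegral_const_mul' _ _ ENNReal.ofReal_ne_top,
    lintegral_add_right _ (hme v (-1)), lintegral_finsetSum _ fun u _ => hme u 1]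
  have hE : ∀ (u : ℕ) (σ : ℝ), |σ| = 1 → ∫⁻ X, ENNReal.ofReal (Real.exp (a *
            (σ * (r u - (learnRisk X (g u) - learnRisk X f)) - r u / 2)))
            ∂(Measure.pi fun _ : Fin n => densityLaw f) ≤ 1 := fun u σ hσ =>
    lintegral_exp_learnRisk_le hB hf hfI hn hl (hg u) (hgI u) hσ
  calc _ ≤ ENNReal.ofReal (3 * r v + 2 * Λ.card / l) * 1 + ENNReal.ofReal (2 / a) *
        (∑ u ∈ Λ, 1 + 1) := by
        gcongr
        · exact hE _ _ (by simp)
        · exact hE _ _ (by simp)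
    _ = ENNReal.ofReal (3 * r v) + ENNReal.ofReal (2 * Λ.card / l) +
        ENNReal.ofReal (2 / a * (Λ.card + 1)) := by
        rw [mul_one, ENNReal.ofReal_add (by have := hr0 v; positivity) (by positivity),
          ENNReal.ofReal_mul (p := 2 / a) (by positivity),
          ENNReal.ofReal_add (by positivity) zero_le_one]
        simp
    _ = _ := by
        rw [add_assoc, ← ENNReal.ofReal_add (by positivity) (by positivity),
          ENNReal.ofReal_mul (by norm_num), hr,
          ofReal_integral_eq_lintegral_ofReal (hd2 v) (ae_of_all _ fun x => sq_nonneg _)]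
        congr 2
        · simp
        · rw [ha]
          field_simp
          ring

theorem clip_mem_Icc (hB : 0 ≤ B) (y : ℝ) : clip 0 B y ∈ Set.Icc 0 B :=
  ⟨le_max_left _ _, max_le hB (min_le_right _ _)⟩

theorem measurable_clip {g : ℝ → ℝ} (hg : Measurable g) (a b : ℝ) :
    Measurable fun x => clip a b (g x) :=
  measurable_const.max (hg.min measurable_const)

theorem clip_eq_self {y : ℝ} (h0 : 0 ≤ y) (hy : y ≤ B) : clip 0 B y = y := by
  rw [clip, min_eq_left hy, max_eq_right h0]

/-- Projection onto an interval is 1-Lipschitz and fixes `z`. -/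
theorem sq_clip_sub_le (y : ℝ) {z : ℝ} (h0 : 0 ≤ z) (hz : z ≤ B) :
    (clip 0 B y - z) ^ 2 ≤ (y - z) ^ 2 := by
  rw [sq_le_sq]
  conv_lhs => rw [← clip_eq_self h0 hz]
  unfold clip
  refine (abs_max_sub_max_le_max _ _ _ _).trans ?_
  rw [sub_self, abs_zero, max_eq_right (abs_nonneg _)]
  refine (abs_min_sub_min_le_max _ _ _ _).trans ?_
  rw [sub_self, abs_zero, max_eq_left (abs_nonneg _)]

variable {φ ψ : ℝ → ℝ} {τ : ℕ} {Υ : ℝ → ℝ → ℝ}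

theorem measurable_thresholdedEstimator (hφ : Measurable φ) (hψ : Measurable ψ)
    (thr : ℕ → ℝ) {m : ℕ} (D : Fin m → ℝ) :
    Measurable (thresholdedEstimator φ ψ τ Υ thr D) := by
  have h1 := measurable_periodized hφ
  have h2 := measurable_periodized hψ
  unfold thresholdedEstimator
  fun_prop

/-- The oracle inequality for the multi-thresholding estimator, with respect to the family of
clipped estimators. -/
theorem risk_multiThresholdEstimator_le (hφ : Measurable φ) (hψ : Measurable ψ) (hB : 0 < B)
    (ρ : ℝ) (hf : IsBoundedDensity B f) {n : ℕ} (hn : learnSize n ≤ n) (hl : 0 < learnSize n)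
    {v : ℕ} (hv : v ∈ indexSet n) :
    risk (n := n) (multiThresholdEstimator φ ψ τ Υ B ρ) f ≤
      3 * (∫⁻ X, ∫⁻ x, ENNReal.ofReal ((thresholdedEstimator φ ψ τ Υ (threshold ρ (trainSize n) v)
          (trainSample X) x - f x) ^ 2) ∂unitMeasure
          ∂(Measure.pi fun _ : Fin n => densityLaw f)) +
        ENNReal.ofReal ((2 * (indexSet n).card + 16 * B * ((indexSet n).card + 1)) /
          learnSize n) := by
  have hprob := hf.isProbabilityMeasure
  -- The aggregation bound wants a density lying in `[0,B]` everywhere. Clipping `f` changes it on a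
  -- null set only and keeps the law.
  set f' : ℝ → ℝ := fun x => clip 0 B (f x) with hf'
  have hae : ∀ᵐ x ∂unitMeasure, f' x = f x := by
    filter_upwards [hf.nonneg, hf.le_bound] with x h0 h1
    exact clip_eq_self h0 h1
  have hlaw : densityLaw f' = densityLaw f := by
    unfold densityLaw
    refine withDensity_congr_ae ?_
    filter_upwards [hae] with x hx
    rw [hx]
  have hfI : ∀ x, f' x ∈ Set.Icc 0 B := fun x => clip_mem_Icc hB.le _
  have hfb : IsBoundedDensity B f' :=
    ⟨measurable_clip hf.measurable 0 B, ae_of_all _ fun x => (hfI x).1,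
      ae_of_all _ fun x => (hfI x).2, by rw [integral_congr_ae hae, hf.integral_eq_one]⟩
  -- After merging, the candidates depend on `X` alone and the empirical risks of fixed functions on
  -- `Y` alone. For fixed `X` the aggregation bound for deterministic functions applies.
  have htrain : ∀ X Y : Fin n → ℝ, trainSample (mergeSample (trainSize n) (X, Y)) =
      trainSample X := by
    intro X Y
    ext i
    have hi : ((Fin.castLE (Nat.sub_le n (learnSize n)) i : Fin n) : ℕ) < trainSize n := i.2
    simp only [trainSample, mergeSample, if_pos hi]
  have hclip : ∀ X Y : Fin n → ℝ, ∀ u, clippedEstimator φ ψ τ Υ B ρ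
      (mergeSample (trainSize n) (X, Y)) u = clippedEstimator φ ψ τ Υ B ρ X u := by
    intro X Y u
    unfold clippedEstimator
    rw [htrain]
  have hlearn : ∀ (X Y : Fin n → ℝ) (g : ℝ → ℝ),
      learnRisk (mergeSample (trainSize n) (X, Y)) g = learnRisk Y g := by
    intro X Y g
    unfold learnRisk
    congr 1
    refine Finset.sum_congr rfl fun i hi => ?_
    rw [Finset.mem_filter] at hi
    simp [mergeSample, not_lt.2 hi.2]
  unfold risk
  refine (lintegral_pi_le_merge (trainSize n) _).trans ?_
  set κ := ENNReal.ofReal ((2 * (indexSet n).card + 16 * B * ((indexSet n).card + 1)) /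
          learnSize n) with hκ
  have hX : ∀ X : Fin n → ℝ, ∫⁻ Y, (∫⁻ x, ENNReal.ofReal
      ((multiThresholdEstimator φ ψ τ Υ B ρ (mergeSample (trainSize n) (X, Y)) x - f x) ^ 2)
        ∂unitMeasure) ∂(Measure.pi fun _ : Fin n => densityLaw f) ≤
      3 * (∫⁻ x, ENNReal.ofReal ((thresholdedEstimator φ ψ τ Υ (threshold ρ (trainSize n) v)
          (trainSample X) x - f x) ^ 2) ∂unitMeasure) + κ := by
    intro X
    have hg : ∀ u, Measurable (clippedEstimator φ ψ τ Υ B ρ X u) := fun u =>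
      measurable_clip (measurable_thresholdedEstimator hφ hψ _ _) 0 B
    have h := lintegral_expWeight_aggregate_le hB hfb hfI hn hl hv hg
      (fun u x => clip_mem_Icc hB.le _)
    rw [hlaw] at h
    refine (le_of_eq ?_).trans (h.trans ?_)
    · refine lintegral_congr fun Y => lintegral_congr_ae ?_
      filter_upwards [hae] with x hx
      simp only [multiThresholdEstimator, weight, hclip, hlearn, hx]
    · gcongr ?_ + _
      refine mul_le_mul_right (lintegral_mono_ae ?_) _
      filter_upwards [hae, hf.nonneg, hf.le_bound] with x hx h0 h1
      rw [hx]
      exact ENNReal.ofReal_le_ofReal (sq_clip_sub_le _ h0 h1)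
  refine (lintegral_mono hX).trans ?_
  rw [lintegral_add_right _ measurable_const, lintegral_const_mul' _ _ (by norm_num)]
  simp

/-- The trivial bound for the risk. -/
theorem risk_multiThresholdEstimator_le_sq (hB : 0 ≤ B) (ρ : ℝ) (hf : IsBoundedDensity B f)
    (n : ℕ) :
    risk (n := n) (multiThresholdEstimator φ ψ τ Υ B ρ) f ≤ ENNReal.ofReal (B ^ 2) := by
  have hprob := hf.isProbabilityMeasure
  unfold risk
  calc _ ≤ ∫⁻ _ : Fin n → ℝ, ∫⁻ _ : ℝ, ENNReal.ofReal (B ^ 2) ∂unitMeasure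
        ∂(Measure.pi fun _ : Fin n => densityLaw f) := by
        refine lintegral_mono fun X => lintegral_mono_ae ?_
        filter_upwards [hf.nonneg, hf.le_bound] with x h0 h1
        refine ENNReal.ofReal_le_ofReal ?_
        set S := ∑ γ ∈ indexSet n,
          Real.exp (-(learnSize n : ℝ) * learnRisk X (clippedEstimator φ ψ τ Υ B ρ X γ)) with hS
        have hS0 : 0 < S := Finset.sum_pos (fun _ _ => Real.exp_pos _) ⟨0, by simp [indexSet]⟩
        have hw0 : ∀ u, 0 ≤ weight φ ψ τ Υ B ρ X u := fun u =>
          div_nonneg (Real.exp_pos _).le hS0.le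
        have hw1 : ∑ u ∈ indexSet n, weight φ ψ τ Υ B ρ X u = 1 := by
          unfold weight
          rw [← Finset.sum_div]
          exact div_self hS0.ne'
        have hc : ∀ u, clippedEstimator φ ψ τ Υ B ρ X u x ∈ Set.Icc 0 B := fun u =>
          clip_mem_Icc hB _
        have h2 : 0 ≤ multiThresholdEstimator φ ψ τ Υ B ρ X x :=
          Finset.sum_nonneg fun u _ => mul_nonneg (hw0 u) (hc u).1
        have h3 : multiThresholdEstimator φ ψ τ Υ B ρ X x ≤ B := by
          calc _ ≤ ∑ u ∈ indexSet n, weight φ ψ τ Υ B ρ X u * B :=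
                Finset.sum_le_sum fun u _ => mul_le_mul_of_nonneg_left (hc u).2 (hw0 u)
            _ = B := by rw [← Finset.sum_mul, hw1, one_mul]
        rw [← sq_abs]
        exact pow_le_pow_left₀ (abs_nonneg _) (abs_le.2 ⟨by linarith, by linarith⟩) 2
    _ = _ := by simp

end Learn

/-! ### Expansions in the wavelet basis -/

section Parseval

theorem coeFn_sum_smul_ae {ι : Type*} {μ : Measure ℝ} {b : ι → Lp ℝ 2 μ} {e : ι → ℝ → ℝ}
    (hbe : ∀ i, (b i : ℝ → ℝ) =ᵐ[μ] e i) (c : ι → ℝ) (s : Finset ι) :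
    ((∑ i ∈ s, c i • b i : Lp ℝ 2 μ) : ℝ → ℝ) =ᵐ[μ] fun x => ∑ i ∈ s, c i * e i x := by
  classical
  induction s using Finset.induction_on with
  | empty =>
    simp only [Finset.sum_empty]
    exact Lp.coeFn_zero _ _ _
  | insert i s hi ih =>
    rw [Finset.sum_insert hi]
    filter_upwards [Lp.coeFn_add (c i • b i) (∑ i ∈ s, c i • b i), Lp.coeFn_smul (c i) (b i), ih,
      hbe i] with x h1 h2 h3 h4
    rw [h1, Pi.add_apply, h2, h3, Pi.smul_apply, h4, Finset.sum_insert hi, smul_eq_mul]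

/-- Parseval's identity for the distance of a function to a finite linear combination of the
elements of a Hilbert basis. -/
theorem lintegral_sq_sum_sub {ι : Type} (b : HilbertBasis ι ℝ (Lp ℝ 2 unitMeasure))
    {e : ι → ℝ → ℝ} (hbe : ∀ i, (b i : ℝ → ℝ) =ᵐ[unitMeasure] e i) (c : ι → ℝ) (s : Finset ι)
    (hcs : ∀ i ∉ s, c i = 0) {f : ℝ → ℝ} (hf : MemLp f 2 unitMeasure) :
    ∫⁻ x, ENNReal.ofReal ((∑ i ∈ s, c i * e i x - f x) ^ 2) ∂unitMeasure =
      ∑' i, ENNReal.ofReal ((c i - coeff f (e i)) ^ 2) := by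
  classical
  set F : Lp ℝ 2 unitMeasure := hf.toLp f with hF
  set v : Lp ℝ 2 unitMeasure := ∑ i ∈ s, c i • b i - F with hv
  have hvae : (v : ℝ → ℝ) =ᵐ[unitMeasure] fun x => ∑ i ∈ s, c i * e i x - f x := by
    filter_upwards [Lp.coeFn_sub (∑ i ∈ s, c i • b i) F, coeFn_sum_smul_ae hbe c s,
      hf.coeFn_toLp] with x h1 h2 h3
    rw [h1, Pi.sub_apply, h2, h3]
  have hinner : ∀ i, inner ℝ (b i) v = c i - coeff f (e i) := by
    intro i
    have h1 : inner ℝ (b i) F = coeff f (e i) := by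
      rw [L2.inner_def, coeff]
      refine integral_congr_ae ?_
      filter_upwards [hbe i, hf.coeFn_toLp] with x h2 h3
      rw [h2, h3]
      rfl
    rw [hv, inner_sub_right, h1, inner_sum]
    congr 1
    simp_rw [inner_smul_right, orthonormal_iff_ite.1 b.orthonormal]
    by_cases hi : i ∈ s
    · simp [hi]
    · simp [hi, hcs i hi]
  have hsum := b.hasSum_inner_mul_inner v v
  have hsq : ∀ i, inner ℝ v (b i) * inner ℝ (b i) v = (c i - coeff f (e i)) ^ 2 := by
    intro i
    rw [real_inner_comm, hinner, sq]
  simp_rw [hsq] at hsum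
  rw [← ENNReal.ofReal_tsum_of_nonneg (fun i => sq_nonneg _) hsum.summable, hsum.tsum_eq,
    L2.inner_def, ofReal_integral_eq_lintegral_ofReal (L2.integrable_inner v v)]
  · refine lintegral_congr_ae ?_
    filter_upwards [hvae] with x hx
    rw [hx]
    simp only [RCLike.inner_apply, conj_trivial]
    rw [sq]
  · exact ae_of_all _ fun x => real_inner_self_nonneg

theorem lintegral_sq_eq_one {ι : Type} (b : HilbertBasis ι ℝ (Lp ℝ 2 unitMeasure)) {i : ι}
    {e : ℝ → ℝ} (hbe : (b i : ℝ → ℝ) =ᵐ[unitMeasure] e) :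
    ∫⁻ x, ENNReal.ofReal (e x ^ 2) ∂unitMeasure = 1 := by
  have h1 : inner ℝ (b i) (b i) = (1 : ℝ) := by
    rw [real_inner_self_eq_norm_sq, b.orthonormal.1 i, one_pow]
  have h2 := ofReal_integral_eq_lintegral_ofReal (L2.integrable_inner (𝕜 := ℝ) (b i) (b i))
    (ae_of_all _ fun x => real_inner_self_nonneg)
  rw [← L2.inner_def, h1, ENNReal.ofReal_one] at h2
  rw [h2]
  refine lintegral_congr_ae ?_
  filter_upwards [hbe] with x hx
  rw [hx]
  simp only [RCLike.inner_apply, conj_trivial]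
  rw [sq]

variable {φ ψ : ℝ → ℝ} {τ : ℕ}

theorem IsPeriodizedWaveletBasis.lintegral_father_sq (h : IsPeriodizedWaveletBasis φ ψ τ) {k : ℕ}
    (hk : k < 2 ^ τ) :
    ∫⁻ x, ENNReal.ofReal (periodized φ τ k x ^ 2) ∂unitMeasure = 1 := by
  obtain ⟨b, hb, -⟩ := h.hilbertBasis
  exact lintegral_sq_eq_one b (hb ⟨k, hk⟩)

theorem IsPeriodizedWaveletBasis.lintegral_mother_sq (h : IsPeriodizedWaveletBasis φ ψ τ)
    {j k : ℕ} (hj : τ ≤ j) (hk : k < 2 ^ j) :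
    ∫⁻ x, ENNReal.ofReal (periodized ψ j k x ^ 2) ∂unitMeasure = 1 := by
  obtain ⟨b, -, hb⟩ := h.hilbertBasis
  obtain ⟨i, rfl⟩ := Nat.exists_eq_add_of_le hj
  exact lintegral_sq_eq_one b (hb i ⟨k, hk⟩)

/-- The squared error of an estimator given by its wavelet coefficients. -/
theorem IsPeriodizedWaveletBasis.lintegral_sq_sub (h : IsPeriodizedWaveletBasis φ ψ τ) (a : ℕ → ℝ)
    (c : ℕ → ℕ → ℝ) (J : ℕ) {f : ℝ → ℝ} (hf : MemLp f 2 unitMeasure) :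
    ∫⁻ x, ENNReal.ofReal ((∑ k ∈ Finset.range (2 ^ τ), a k * periodized φ τ k x +
        ∑ j ∈ Finset.Icc τ J, ∑ k ∈ Finset.range (2 ^ j), c j k * periodized ψ j k x - f x) ^ 2)
        ∂unitMeasure =
      ∑ k ∈ Finset.range (2 ^ τ), ENNReal.ofReal ((a k - coeff f (periodized φ τ k)) ^ 2) +
        ∑' i : ℕ, ∑ k ∈ Finset.range (2 ^ (τ + i)),
          ENNReal.ofReal (((if τ + i ≤ J then c (τ + i) k else 0) -
            coeff f (periodized ψ (τ + i) k)) ^ 2) := by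
  obtain ⟨b, hb1, hb2⟩ := h.hilbertBasis
  set e : Fin (2 ^ τ) ⊕ (Σ i : ℕ, Fin (2 ^ (τ + i))) → ℝ → ℝ :=
    Sum.elim (fun k => periodized φ τ k) (fun p => periodized ψ (τ + p.1) p.2) with he
  set C : Fin (2 ^ τ) ⊕ (Σ i : ℕ, Fin (2 ^ (τ + i))) → ℝ :=
    Sum.elim (fun k => a k) (fun p => if τ + p.1 ≤ J then c (τ + p.1) p.2 else 0) with hC
  -- The truncated difference `J + 1 - τ` is zero when `J < τ`, in agreement with the empty interval
  -- `Finset.Icc τ J`.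
  set s : Finset (Fin (2 ^ τ) ⊕ (Σ i : ℕ, Fin (2 ^ (τ + i)))) :=
    Finset.univ.disjSum ((Finset.range (J + 1 - τ)).sigma fun _ => Finset.univ) with hs
  have hbe : ∀ i, (b i : ℝ → ℝ) =ᵐ[unitMeasure] e i := by
    rintro (k | ⟨i, k⟩)
    · exact hb1 k
    · exact hb2 i k
  have hcs : ∀ i ∉ s, C i = 0 := by
    rintro (k | ⟨i, k⟩) hi
    · simp [hs] at hi
    · simp only [hs, Finset.inr_mem_disjSum, Finset.mem_sigma, Finset.mem_range, Finset.mem_univ,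
        and_true] at hi
      simp only [hC, Sum.elim_inr]
      rw [if_neg (by omega)]
  have hmain := lintegral_sq_sum_sub b hbe C s hcs hf
  rw [Summable.tsum_sum ENNReal.summable ENNReal.summable, ENNReal.tsum_sigma'] at hmain
  simp only [tsum_fintype, he, hC, Sum.elim_inl, Sum.elim_inr] at hmain
  rw [Finset.sum_range (n := 2 ^ τ) (f := fun k =>
    ENNReal.ofReal ((a k - coeff f (periodized φ τ k)) ^ 2))]
  have hR : ∀ i : ℕ, ∑ k ∈ Finset.range (2 ^ (τ + i)),
          ENNReal.ofReal (((if τ + i ≤ J then c (τ + i) k else 0) -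
            coeff f (periodized ψ (τ + i) k)) ^ 2) =
      ∑ k : Fin (2 ^ (τ + i)), ENNReal.ofReal (((if τ + i ≤ J then c (τ + i) k else 0) -
            coeff f (periodized ψ (τ + i) k)) ^ 2) := fun i => by
    rw [Finset.sum_range]
  simp_rw [hR]
  rw [← hmain]
  refine lintegral_congr fun x => ?_
  congr 3
  rw [hs, Finset.sum_disjSum, Finset.sum_sigma]
  simp only [Sum.elim_inl, Sum.elim_inr]
  congr 1
  · rw [Finset.sum_range]
  · have hIcc : Finset.Icc τ J = Finset.Ico τ (J + 1) := by
      ext; simp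
    rw [hIcc, Finset.sum_Ico_eq_sum_range]
    refine Finset.sum_congr rfl fun i hi => ?_
    rw [Finset.mem_range] at hi
    rw [Finset.sum_range]
    refine Finset.sum_congr rfl fun k _ => ?_
    rw [if_pos (by omega)]

end Parseval

/-! ### The risk of a thresholded estimator -/

section Risk

variable {φ ψ : ℝ → ℝ} {τ : ℕ} {B : ℝ} {f : ℝ → ℝ}

theorem IsBoundedDensity.memLp_two (hf : IsBoundedDensity B f) : MemLp f 2 unitMeasure := by
  refine MemLp.of_bound hf.measurable.aestronglyMeasurable B ?_
  filter_upwards [hf.nonneg, hf.le_bound] with x h0 h1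
  rwa [Real.norm_eq_abs, abs_of_nonneg h0]

/-- The expected squared deviation of an empirical coefficient beyond the level `t / 2`. -/
noncomputable def deviation (f e : ℝ → ℝ) (m : ℕ) (t : ℝ) : ℝ≥0∞ :=
  ∫⁻ D, ENNReal.ofReal (if t / 2 ≤ |empCoeff D e - coeff f e| then
    |empCoeff D e - coeff f e| ^ 2 else 0) ∂(Measure.pi fun _ : Fin m => densityLaw f)

theorem measurable_deviation_integrand {e : ℝ → ℝ} (he : Measurable e) (c : ℝ) (m : ℕ) (t : ℝ) :
    Measurable fun D : Fin m → ℝ => ENNReal.ofReal (if t / 2 ≤ |empCoeff D e - c| then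
      |empCoeff D e - c| ^ 2 else 0) := by
  have h := (measurable_empCoeff (m := m) he).sub_const c
  refine Measurable.ennreal_ofReal (Measurable.ite ?_ (by fun_prop) measurable_const)
  exact measurableSet_le measurable_const (by fun_prop)

theorem lintegral_empCoeff_sub_coeff_sq_le (hB : 0 ≤ B) (hf : IsBoundedDensity B f) {m : ℕ}
    (hm : 0 < m) {e : ℝ → ℝ} (he : Measurable e)
    (h1 : ∫⁻ x, ENNReal.ofReal (e x ^ 2) ∂unitMeasure ≤ 1) :
    ∫⁻ D, ENNReal.ofReal ((empCoeff D e - coeff f e) ^ 2)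
      ∂(Measure.pi fun _ : Fin m => densityLaw f) ≤ ENNReal.ofReal (B / m) := by
  have := hf.isProbabilityMeasure
  obtain ⟨h2, h3⟩ := memLp_two_densityLaw hB hf he h1
  rw [← integral_densityLaw hf]
  exact lintegral_empCoeff_sub_sq_le hm h2 h3

/-- The plain variance bound, for levels with zero threshold and for coarse levels where no sup
bound on the wavelet is at hand. -/
theorem deviation_le (hB : 0 ≤ B) (hf : IsBoundedDensity B f) {m : ℕ}
    (hm : 0 < m) {e : ℝ → ℝ} (he : Measurable e)
    (h1 : ∫⁻ x, ENNReal.ofReal (e x ^ 2) ∂unitMeasure ≤ 1) (t : ℝ) :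
    deviation f e m t ≤ ENNReal.ofReal (B / m) := by
  refine le_trans (lintegral_mono fun D => ENNReal.ofReal_le_ofReal ?_)
    (lintegral_empCoeff_sub_coeff_sq_le hB hf hm he h1)
  split_ifs
  · rw [sq_abs]
  · exact sq_nonneg _

theorem deviation_le_exp (hB : 1 ≤ B) (hf : IsBoundedDensity B f) {m : ℕ}
    (hm : 0 < m) {e : ℝ → ℝ} (he : Measurable e)
    (h1 : ∫⁻ x, ENNReal.ofReal (e x ^ 2) ∂unitMeasure ≤ 1) {S t : ℝ} (hS : 0 ≤ S) (ht : 0 < t)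
    (heS : ∀ᵐ x ∂unitMeasure, |e x| ≤ S)
    (hlarge : 2 * B + (S + B) * (t / 2) ≤ m * (t / 2) ^ 2) :
    deviation f e m t ≤ ENNReal.ofReal (8 * (t / 2) ^ 2 *
      Real.exp (-(m * (t / 2) ^ 2 / (2 * (2 * B + (S + B) * (t / 2)))))) := by
  have := hf.isProbabilityMeasure
  have hB0 : 0 ≤ B := by linarith
  obtain ⟨h2, h3⟩ := memLp_two_densityLaw hB0 hf he h1
  -- The squared mean is at most the second moment, hence at most `B ≤ B²`. The centered variable is
  -- then bounded by `S + B`.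
  have hc : |∫ y, e y ∂densityLaw f| ≤ B := by
    have hvar : (∫ y, e y ∂densityLaw f) ^ 2 ≤ B := by
      have h4 := ProbabilityTheory.variance_nonneg e (densityLaw f)
      rw [ProbabilityTheory.variance_eq_sub h2] at h4
      simp only [Pi.pow_apply] at h4
      linarith
    refine abs_le_of_sq_le_sq (hvar.trans ?_) hB0
    nlinarith
  unfold deviation
  rw [← integral_densityLaw hf]
  refine lintegral_empCoeff_sub_sq_tail_le hm he (by positivity) (by linarith) (by linarith) ?_ h3
    hlarge
  filter_upwards [(densityLaw_absolutelyContinuous f).ae_le heS] with x hx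
  exact (abs_sub _ _).trans (add_le_add hx hc)

/-- The contribution of level `j` to the bound for the risk of a thresholded estimator. -/
noncomputable def levelBound (ψ f : ℝ → ℝ) (C₁ C₂ : ℝ) (thr : ℕ → ℝ) (m j : ℕ) : ℝ≥0∞ :=
  if j ≤ finestLevel m then
    ENNReal.ofReal C₁ * (∑ k ∈ Finset.range (2 ^ j),
        ENNReal.ofReal ((min |coeff f (periodized ψ j k)| (C₂ * thr j)) ^ 2) +
      ∑ k ∈ Finset.range (2 ^ j), deviation f (periodized ψ j k) m (thr j))
  else ∑ k ∈ Finset.range (2 ^ j), ENNReal.ofReal (coeff f (periodized ψ j k) ^ 2)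

/-- Parseval reduces the loss to coefficients, and the thresholding inequality is applied to each
with `x` the empirical and `y` the true one. Father coefficients cost their variance; levels beyond
the finest one cost their full energy. -/
theorem lintegral_thresholdedEstimator_le (hwav : IsPeriodizedWaveletBasis φ ψ τ)
    {Υ : ℝ → ℝ → ℝ} {C₁ C₂ : ℝ} (hC₁ : 0 < C₁)
    (hΥ : ∀ u, 0 ≤ u → ∀ x y : ℝ, |Υ u x - y| ^ 2 ≤
      C₁ * ((min |y| (C₂ * u)) ^ 2 + (if u / 2 ≤ |x - y| then |x - y| ^ 2 else 0)))
    (hB : 0 ≤ B) (hf : IsBoundedDensity B f) {n : ℕ} (hm : 0 < trainSize n) {thr : ℕ → ℝ}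
    (hthr : ∀ j, 0 ≤ thr j) :
    ∫⁻ X, ∫⁻ x, ENNReal.ofReal ((thresholdedEstimator φ ψ τ Υ thr (trainSample X) x - f x) ^ 2)
        ∂unitMeasure ∂(Measure.pi fun _ : Fin n => densityLaw f) ≤
      ENNReal.ofReal (2 ^ τ * (B / trainSize n)) +
        ∑' i : ℕ, levelBound ψ f C₁ C₂ thr (trainSize n) (τ + i) := by
  have hprob := hf.isProbabilityMeasure
  set m := trainSize n with hmdef
  -- An explicit measurable majorant of the loss, so that expectation and sums can be exchanged
  -- without any measurability of the loss itself.
  set H : (Fin m → ℝ) → ℝ≥0∞ := fun D =>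
    ∑ k ∈ Finset.range (2 ^ τ),
        ENNReal.ofReal ((empCoeff D (periodized φ τ k) - coeff f (periodized φ τ k)) ^ 2) +
      ∑' i : ℕ, if τ + i ≤ finestLevel m then
        ENNReal.ofReal C₁ * (∑ k ∈ Finset.range (2 ^ (τ + i)),
            ENNReal.ofReal ((min |coeff f (periodized ψ (τ + i) k)| (C₂ * thr (τ + i))) ^ 2) +
          ∑ k ∈ Finset.range (2 ^ (τ + i)), ENNReal.ofReal
            (if thr (τ + i) / 2 ≤ |empCoeff D (periodized ψ (τ + i) k) -
                coeff f (periodized ψ (τ + i) k)| then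
              |empCoeff D (periodized ψ (τ + i) k) - coeff f (periodized ψ (τ + i) k)| ^ 2 else 0))
      else ∑ k ∈ Finset.range (2 ^ (τ + i)),
        ENNReal.ofReal (coeff f (periodized ψ (τ + i) k) ^ 2) with hH
  have hmφ := measurable_periodized hwav.measurable_father
  have hmψ := measurable_periodized hwav.measurable_mother
  have hmA : ∀ k, Measurable fun D : Fin m → ℝ => ENNReal.ofReal
      ((empCoeff D (periodized φ τ k) - coeff f (periodized φ τ k)) ^ 2) := fun k => by
    have := measurable_empCoeff (m := m) (hmφ τ k)
    fun_prop
  have hmD : ∀ j k, Measurable fun D : Fin m → ℝ => ENNReal.ofReal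
            (if thr j / 2 ≤ |empCoeff D (periodized ψ j k) - coeff f (periodized ψ j k)| then
              |empCoeff D (periodized ψ j k) - coeff f (periodized ψ j k)| ^ 2 else 0) :=
    fun j k => measurable_deviation_integrand (hmψ j k) _ _ _
  have hmL : ∀ i : ℕ, Measurable fun D : Fin m → ℝ => if τ + i ≤ finestLevel m then
        ENNReal.ofReal C₁ * (∑ k ∈ Finset.range (2 ^ (τ + i)),
            ENNReal.ofReal ((min |coeff f (periodized ψ (τ + i) k)| (C₂ * thr (τ + i))) ^ 2) +
          ∑ k ∈ Finset.range (2 ^ (τ + i)), ENNReal.ofReal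
            (if thr (τ + i) / 2 ≤ |empCoeff D (periodized ψ (τ + i) k) -
                coeff f (periodized ψ (τ + i) k)| then
              |empCoeff D (periodized ψ (τ + i) k) - coeff f (periodized ψ (τ + i) k)| ^ 2 else 0))
      else ∑ k ∈ Finset.range (2 ^ (τ + i)),
        ENNReal.ofReal (coeff f (periodized ψ (τ + i) k) ^ 2) := by
    intro i
    split_ifs
    · exact (measurable_const.add (Finset.measurable_fun_sum _ fun k _ => hmD _ k)).const_mul _
    · exact measurable_const
  have hmA' : Measurable fun D : Fin m → ℝ => ∑ k ∈ Finset.range (2 ^ τ), ENNReal.ofReal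
      ((empCoeff D (periodized φ τ k) - coeff f (periodized φ τ k)) ^ 2) :=
    Finset.measurable_fun_sum _ fun k _ => hmA k
  have hHm : Measurable H := hmA'.add (Measurable.tsum hmL)
  have hpt : ∀ D : Fin m → ℝ, ∫⁻ x, ENNReal.ofReal
      ((thresholdedEstimator φ ψ τ Υ thr D x - f x) ^ 2) ∂unitMeasure ≤ H D := by
    intro D
    unfold thresholdedEstimator
    rw [hwav.lintegral_sq_sub (fun k => empCoeff D (periodized φ τ k))
      (fun j k => Υ (thr j) (empCoeff D (periodized ψ j k))) (finestLevel m) hf.memLp_two, hH]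
    simp only
    gcongr with i
    split_ifs with hj
    · rw [← Finset.sum_add_distrib, Finset.mul_sum]
      refine Finset.sum_le_sum fun k _ => ?_
      rw [← ENNReal.ofReal_add (sq_nonneg _) (by positivity), ← ENNReal.ofReal_mul hC₁.le]
      refine ENNReal.ofReal_le_ofReal ?_
      rw [← sq_abs]
      exact hΥ _ (hthr _) _ _
    · simp
  calc _ ≤ ∫⁻ X : Fin n → ℝ, H (trainSample X) ∂(Measure.pi fun _ : Fin n => densityLaw f) :=
        lintegral_mono fun X => hpt _
    _ = ∫⁻ D, H D ∂(Measure.pi fun _ : Fin m => densityLaw f) := by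
        have hmap : (Measure.pi fun _ : Fin n => densityLaw f).map trainSample =
            Measure.pi fun _ : Fin m => densityLaw f := map_trainSample_pi n
        rw [← hmap, lintegral_map hHm]
        refine measurable_pi_lambda _ fun i => ?_
        exact measurable_pi_apply _
    _ ≤ _ := by
        rw [hH, lintegral_add_left hmA', lintegral_finsetSum _ fun k _ => hmA k,
          lintegral_tsum fun i => (hmL i).aemeasurable]
        refine add_le_add ?_ (ENNReal.tsum_le_tsum fun i => ?_)
        · calc _ ≤ ∑ k ∈ Finset.range (2 ^ τ), ENNReal.ofReal (B / m) := by
                refine Finset.sum_le_sum fun k hk => ?_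
                exact lintegral_empCoeff_sub_coeff_sq_le hB hf hm (hmφ τ k)
                  (hwav.lintegral_father_sq (Finset.mem_range.1 hk)).le
            _ = _ := by
                rw [Finset.sum_const, Finset.card_range, nsmul_eq_mul,
                  ENNReal.ofReal_mul (by positivity)]
                congr 1
                rw [ENNReal.ofReal_pow zero_le_two]
                simp
        · unfold levelBound
          split_ifs
          · rw [lintegral_const_mul' _ _ ENNReal.ofReal_ne_top, lintegral_add_left measurable_const,
              lintegral_finsetSum _ fun k _ => hmD _ k, lintegral_const, measure_univ, mul_one]
            rfl
          · simp

end Risk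

/-! ### Consequences of membership in a Besov ball -/

section Besov

theorem le_lNorm {ι : Type} {r : ℝ≥0∞} (hr : 1 ≤ r) (a : ι → ℝ≥0∞) (i : ι) : a i ≤ lNorm r a := by
  unfold lNorm
  split_ifs with h
  · exact le_iSup a i
  · have hr0 : 0 < r.toReal := ENNReal.toReal_pos (zero_lt_one.trans_le hr).ne' h
    calc a i = (a i ^ r.toReal) ^ (1 / r.toReal) := by
          rw [← ENNReal.rpow_mul, mul_one_div_cancel hr0.ne', ENNReal.rpow_one]
      _ ≤ _ := ENNReal.rpow_le_rpow (ENNReal.le_tsum i) (by positivity)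

/-- Since a single term is at most the `ℓ^q` norm, `B^s_{p,q}` embeds in `B^s_{p,∞}`. Nothing else
about `q` is needed. -/
theorem lNorm_coeff_le_of_mem_besovBall {φ ψ : ℝ → ℝ} {τ : ℕ} {s L : ℝ} {p q : ℝ≥0∞}
    (hq : 1 ≤ q) {f : ℝ → ℝ} (hf : f ∈ besovBall φ ψ τ s p q L) {j : ℕ} (hj : τ ≤ j) :
    lNorm p (fun k : Fin (2 ^ j) => ‖coeff f (periodized ψ j k)‖ₑ) ≤
      ENNReal.ofReal (L * (2 : ℝ) ^ (-((j : ℝ) * (s + 1 / 2 - (p⁻¹).toReal)))) := by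
  obtain ⟨i, rfl⟩ := Nat.exists_eq_add_of_le hj
  have h := (le_lNorm hq (besovLevel φ ψ τ s p f) (i + 1)).trans hf
  simp only [besovLevel] at h
  set σ := (((τ + i : ℕ) : ℝ) * (s + 1 / 2 - (p⁻¹).toReal)) with hσ
  have h2 : (0 : ℝ) < (2 : ℝ) ^ σ := by positivity
  calc _ = ENNReal.ofReal ((2 : ℝ) ^ (-σ)) * (ENNReal.ofReal ((2 : ℝ) ^ σ) *
        lNorm p (fun k : Fin (2 ^ (τ + i)) => ‖coeff f (periodized ψ (τ + i) k)‖ₑ)) := by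
        rw [← mul_assoc, ← ENNReal.ofReal_mul (by positivity), ← Real.rpow_add two_pos,
          neg_add_cancel, Real.rpow_zero, ENNReal.ofReal_one, one_mul]
    _ ≤ ENNReal.ofReal ((2 : ℝ) ^ (-σ)) * ENNReal.ofReal L := by gcongr
    _ = _ := by rw [← ENNReal.ofReal_mul (by positivity), mul_comm]

theorem sum_rpow_le_of_lNorm_le {p : ℝ≥0∞} (hp : 1 ≤ p) (hp' : p ≠ ∞) {M : ℕ} {β : ℕ → ℝ} {A : ℝ}
    (hA : 0 ≤ A) (h : lNorm p (fun k : Fin M => ‖β k‖ₑ) ≤ ENNReal.ofReal A) :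
    ∑ k ∈ Finset.range M, |β k| ^ p.toReal ≤ A ^ p.toReal := by
  have hp0 : 0 < p.toReal := ENNReal.toReal_pos (zero_lt_one.trans_le hp).ne' hp'
  rw [lNorm, if_neg hp', one_div, ENNReal.rpow_inv_le_iff hp0,
    ENNReal.ofReal_rpow_of_nonneg hA hp0.le, tsum_fintype] at h
  have h1 : ∀ k : Fin M, ‖β k‖ₑ ^ p.toReal = ENNReal.ofReal (|β k| ^ p.toReal) := fun k => by
    rw [← ofReal_norm, Real.norm_eq_abs, ENNReal.ofReal_rpow_of_nonneg (abs_nonneg _) hp0.le]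
  simp_rw [h1] at h
  rw [← ENNReal.ofReal_sum_of_nonneg (fun _ _ => by positivity),
    ENNReal.ofReal_le_ofReal_iff (by positivity)] at h
  rwa [Finset.sum_range]

/-- The power mean inequality between `ℓ²` and `ℓ^p`; `p = ∞` is treated apart because no finite
exponent is available. -/
theorem sum_sq_le_of_lNorm_le {p : ℝ≥0∞} (hp : 2 ≤ p) {M : ℕ} (hM : 0 < M) {β : ℕ → ℝ} {A : ℝ}
    (hA : 0 ≤ A) (h : lNorm p (fun k : Fin M => ‖β k‖ₑ) ≤ ENNReal.ofReal A) :
    ∑ k ∈ Finset.range M, β k ^ 2 ≤ (M : ℝ) ^ (1 - 2 * (p⁻¹).toReal) * A ^ 2 := by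
  have hM' : (0 : ℝ) < M := by exact_mod_cast hM
  by_cases hp' : p = ∞
  · rw [lNorm, if_pos hp', iSup_le_iff] at h
    subst hp'
    simp only [ENNReal.inv_top, ENNReal.toReal_zero, mul_zero, sub_zero, Real.rpow_one]
    calc ∑ k ∈ Finset.range M, β k ^ 2 ≤ ∑ k ∈ Finset.range M, A ^ 2 := by
          refine Finset.sum_le_sum fun k hk => ?_
          have h1 := h ⟨k, Finset.mem_range.1 hk⟩
          rw [← ofReal_norm, Real.norm_eq_abs, ENNReal.ofReal_le_ofReal_iff hA] at h1
          rw [← sq_abs]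
          exact pow_le_pow_left₀ (abs_nonneg _) h1 2
      _ = _ := by simp
  · have hp1 : 1 ≤ p := le_trans (by norm_num) hp
    have h2 := sum_rpow_le_of_lNorm_le hp1 hp' hA h
    have hpr : 2 ≤ p.toReal := by
      have := ENNReal.toReal_mono hp' hp
      simpa using this
    rw [ENNReal.toReal_inv]
    set r := p.toReal with hr
    have hr0 : 0 < r := by linarith
    have h3 := Real.rpow_sum_le_const_mul_sum_rpow (Finset.range M) (fun k => β k ^ 2)
      (p := r / 2) (by linarith)
    have h4 : ∀ k, |β k ^ 2| ^ (r / 2) = |β k| ^ r := fun k => by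
      rw [abs_pow, ← Real.rpow_natCast, ← Real.rpow_mul (abs_nonneg _)]
      congr 1
      push_cast
      ring
    simp_rw [h4, abs_of_nonneg (sq_nonneg (β _)), Finset.card_range] at h3
    have h5 : (∑ k ∈ Finset.range M, β k ^ 2) ^ (r / 2) ≤
        ((M : ℝ) ^ (1 - 2 * r⁻¹) * A ^ 2) ^ (r / 2) := by
      refine h3.trans ?_
      rw [Real.mul_rpow (by positivity) (by positivity), ← Real.rpow_mul hM'.le,
        ← Real.rpow_natCast A 2, ← Real.rpow_mul hA]
      have e1 : (1 - 2 * r⁻¹) * (r / 2) = r / 2 - 1 := by field_simp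
      have e2 : ((2 : ℕ) : ℝ) * (r / 2) = r := by push_cast; ring
      rw [e1, e2]
      gcongr
    exact (Real.rpow_le_rpow_iff (Finset.sum_nonneg fun _ _ => sq_nonneg _) (by positivity)
      (by positivity)).1 h5

/-- Write `w² = w^p w^{2-p}` for the minimum `w` and bound one factor by `|b|`, the other by `a`. -/
theorem min_sq_le_rpow_mul_rpow (b : ℝ) {a p : ℝ} (ha : 0 ≤ a) (hp0 : 0 ≤ p) (hp2 : p ≤ 2) :
    (min |b| a) ^ 2 ≤ |b| ^ p * a ^ (2 - p) := by
  set w := min |b| a with hw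
  have hw0 : 0 ≤ w := le_min (abs_nonneg _) ha
  rcases hw0.eq_or_lt with h | h
  · rw [← h, zero_pow two_ne_zero]
    positivity
  · calc w ^ 2 = w ^ p * w ^ (2 - p) := by
          rw [← Real.rpow_add h, ← Real.rpow_natCast]
          congr 1
          push_cast
          ring
      _ ≤ _ := by
          have h1 : w ≤ |b| := min_le_left _ _
          have h2 : w ≤ a := min_le_right _ _
          have h3 : 0 ≤ 2 - p := by linarith
          gcongr

theorem sum_min_sq_le_of_sum_rpow_le {M : ℕ} {β : ℕ → ℝ} {a p A : ℝ} (ha : 0 ≤ a) (hp0 : 0 ≤ p)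
    (hp2 : p ≤ 2) (h : ∑ k ∈ Finset.range M, |β k| ^ p ≤ A ^ p) :
    ∑ k ∈ Finset.range M, (min |β k| a) ^ 2 ≤ a ^ (2 - p) * A ^ p := by
  calc _ ≤ ∑ k ∈ Finset.range M, a ^ (2 - p) * |β k| ^ p :=
        Finset.sum_le_sum fun k _ => by
          rw [mul_comm]
          exact min_sq_le_rpow_mul_rpow _ ha hp0 hp2
    _ ≤ _ := by
        rw [← Finset.mul_sum]
        gcongr

/-- Every `|β k|` is at most `A`, so truncating at `A` changes nothing and the interpolation bound
applies. -/
theorem sum_sq_le_of_sum_rpow_le {M : ℕ} {β : ℕ → ℝ} {p A : ℝ} (hA : 0 < A) (hp0 : 0 < p)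
    (hp2 : p ≤ 2) (h : ∑ k ∈ Finset.range M, |β k| ^ p ≤ A ^ p) :
    ∑ k ∈ Finset.range M, β k ^ 2 ≤ A ^ 2 := by
  have hle : ∀ k ∈ Finset.range M, |β k| ≤ A := fun k hk => by
    have h1 : |β k| ^ p ≤ A ^ p := (Finset.single_le_sum (f := fun k => |β k| ^ p)
      (fun _ _ => by positivity) hk).trans h
    exact (Real.rpow_le_rpow_iff (abs_nonneg _) hA.le hp0).1 h1
  calc _ = ∑ k ∈ Finset.range M, (min |β k| A) ^ 2 :=
        Finset.sum_congr rfl fun k hk => by rw [min_eq_left (hle k hk), sq_abs]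
    _ ≤ A ^ (2 - p) * A ^ p := sum_min_sq_le_of_sum_rpow_le hA.le hp0.le hp2 h
    _ = A ^ 2 := by
        rw [← Real.rpow_add hA, ← Real.rpow_natCast]
        congr 1
        push_cast
        ring

variable {φ ψ : ℝ → ℝ} {τ : ℕ} {s L : ℝ} {p q : ℝ≥0∞} {f : ℝ → ℝ}

/-- The factor `2^{j(1-2/p)}` from the comparison of norms cancels the `p` in the Besov weight. -/
theorem sum_coeff_sq_le_of_two_le (hL : 0 < L) (hp : 2 ≤ p) (hq : 1 ≤ q)
    (hf : f ∈ besovBall φ ψ τ s p q L) {j : ℕ} (hj : τ ≤ j) :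
    ∑ k ∈ Finset.range (2 ^ j), coeff f (periodized ψ j k) ^ 2 ≤
      L ^ 2 * (2 : ℝ) ^ (-(2 * s * j)) := by
  have h := sum_sq_le_of_lNorm_le (β := fun k => coeff f (periodized ψ j k)) hp
    (pow_pos two_pos j) (by positivity) (lNorm_coeff_le_of_mem_besovBall hq hf hj)
  refine h.trans (le_of_eq ?_)
  push_cast
  rw [← Real.rpow_natCast 2 j, ← Real.rpow_mul two_pos.le, mul_pow, ← Real.rpow_natCast _ 2,
    ← Real.rpow_natCast _ 2, ← Real.rpow_mul two_pos.le, mul_left_comm, ← Real.rpow_add two_pos]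
  congr 2
  push_cast
  ring

theorem toReal_mem_of_lt_two (hp : 1 ≤ p) (hp2 : p < 2) : 1 ≤ p.toReal ∧ p.toReal ≤ 2 := by
  have hp' : p ≠ ∞ := (hp2.trans (by norm_num)).ne
  have h1 := ENNReal.toReal_mono hp' hp
  have h2 := ENNReal.toReal_mono (by norm_num) hp2.le
  simp only [ENNReal.toReal_one, ENNReal.toReal_ofNat] at h1 h2
  exact ⟨h1, h2⟩

/-- The decay of the energy of the levels. -/
theorem exists_sum_coeff_sq_le (hL : 0 < L) (hp : 1 ≤ p) (hq : 1 ≤ q) (hs : (p⁻¹).toReal < s)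
    (hf : f ∈ besovBall φ ψ τ s p q L) :
    ∃ κ : ℝ, (κ = 2 * s ∨ 1 ≤ κ) ∧ ∀ j, τ ≤ j →
      ∑ k ∈ Finset.range (2 ^ j), coeff f (periodized ψ j k) ^ 2 ≤
        L ^ 2 * (2 : ℝ) ^ (-(κ * j)) := by
  rcases le_or_gt 2 p with h2 | h2
  · exact ⟨2 * s, Or.inl rfl, fun j hj => sum_coeff_sq_le_of_two_le hL h2 hq hf hj⟩
  -- For `p < 2` the decay may be slower than `2s`, but `s > 1/p` keeps the exponent above 1, and
  -- this suffices because `2^{-j₁}` is at most `log m / m`.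
  · refine ⟨2 * (s + 1 / 2 - (p⁻¹).toReal), Or.inr (by linarith), fun j hj => ?_⟩
    have hp' : p ≠ ∞ := (h2.trans (by norm_num)).ne
    obtain ⟨hr1, hr2⟩ := toReal_mem_of_lt_two hp h2
    have h := sum_sq_le_of_sum_rpow_le (by positivity) (by linarith) hr2
      (sum_rpow_le_of_lNorm_le (β := fun k => coeff f (periodized ψ j k)) hp hp'
      (by positivity) (lNorm_coeff_le_of_mem_besovBall hq hf hj))
    refine h.trans (le_of_eq ?_)
    rw [mul_pow, ← Real.rpow_natCast _ 2, ← Real.rpow_natCast _ 2, ← Real.rpow_mul two_pos.le]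
    congr 2
    push_cast
    ring

/-- The bias due to thresholding at the levels above the balancing level `u`. -/
theorem sum_min_coeff_sq_le (hL : 0 < L) (hp : 1 ≤ p) (hq : 1 ≤ q) (hs : (p⁻¹).toReal < s)
    (hf : f ∈ besovBall φ ψ τ s p q L) {η C : ℝ} (hη : η ≤ 2 * s) (hη' : η ≤ 1 / 2) (hC : 0 ≤ C)
    {m u d : ℕ} (hm : 0 < m) (hd : 1 ≤ d) (hu : (u : ℝ) * (2 * s + 1) ≤ Real.logb 2 m)
    (hj : τ ≤ u + d) :
    ∑ k ∈ Finset.range (2 ^ (u + d)),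
        (min |coeff f (periodized ψ (u + d) k)| (C * Real.sqrt ((d : ℝ) / m))) ^ 2 ≤
      (1 + C) ^ 2 * (1 + L) ^ 2 * (d * (2 : ℝ) ^ (-(η * d))) * (2 : ℝ) ^ (-(2 * s * u)) := by
  have hd' : (1 : ℝ) ≤ d := by exact_mod_cast hd
  have hm' : (0 : ℝ) < m := by exact_mod_cast hm
  have hs0 : 0 < s := ENNReal.toReal_nonneg.trans_lt hs
  rcases le_or_gt 2 p with h2 | h2
  · calc _ ≤ ∑ k ∈ Finset.range (2 ^ (u + d)), coeff f (periodized ψ (u + d) k) ^ 2 := by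
          refine Finset.sum_le_sum fun k _ => ?_
          rw [← sq_abs (coeff _ _)]
          exact pow_le_pow_left₀ (le_min (abs_nonneg _) (by positivity)) (min_le_left _ _) 2
      _ ≤ L ^ 2 * (2 : ℝ) ^ (-(2 * s * (u + d : ℕ))) := sum_coeff_sq_le_of_two_le hL h2 hq hf hj
      _ = L ^ 2 * (2 : ℝ) ^ (-(2 * s * d)) * (2 : ℝ) ^ (-(2 * s * u)) := by
          rw [mul_assoc (L ^ 2), ← Real.rpow_add two_pos]
          congr 2
          push_cast
          ring
      _ ≤ _ := by
          gcongr ?_ * _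
          have h3 : L ^ 2 ≤ (1 + C) ^ 2 * (1 + L) ^ 2 := by
            have : L ^ 2 ≤ (1 + L) ^ 2 := by gcongr; linarith
            have h1 : 1 ≤ (1 + C) ^ 2 := one_le_pow₀ (by linarith)
            nlinarith [sq_nonneg (1 + L)]
          have h4 : (2 : ℝ) ^ (-(2 * s * d)) ≤ d * (2 : ℝ) ^ (-(η * d)) := by
            have : (2 : ℝ) ^ (-(2 * s * d)) ≤ (2 : ℝ) ^ (-(η * d)) := by
              gcongr
              norm_num
            have h5 : (0 : ℝ) < (2 : ℝ) ^ (-(η * d)) := by positivity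
            nlinarith
          exact mul_le_mul h3 h4 (by positivity) (by positivity)
  · have hp' : p ≠ ∞ := (h2.trans (by norm_num)).ne
    obtain ⟨hr1, hr2⟩ := toReal_mem_of_lt_two hp h2
    have h := sum_min_sq_le_of_sum_rpow_le (a := C * Real.sqrt ((d : ℝ) / m)) (by positivity)
      (by linarith) hr2 (sum_rpow_le_of_lNorm_le (β := fun k => coeff f (periodized ψ (u + d) k))
      hp hp' (by positivity) (lNorm_coeff_le_of_mem_besovBall hq hf hj))
    refine h.trans ?_
    rw [ENNReal.toReal_inv] at *
    set r := p.toReal with hr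
    have hrs : 1 < r * s := by
      have : r * r⁻¹ < r * s := by gcongr
      rwa [mul_inv_cancel₀ (by linarith)] at this
    have hmx : (m : ℝ) = (2 : ℝ) ^ Real.logb 2 m :=
      (Real.rpow_logb two_pos (by norm_num) hm').symm
    set x := Real.logb 2 m with hx
    have e1 : (C * Real.sqrt ((d : ℝ) / m)) ^ (2 - r) ≤
        (1 + C) ^ 2 * d * (2 : ℝ) ^ (-(x * (1 - r / 2))) := by
      rw [Real.mul_rpow hC (Real.sqrt_nonneg _), Real.sqrt_eq_rpow, ← Real.rpow_mul (by positivity),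
        Real.div_rpow (by positivity) hm'.le, div_eq_mul_inv, ← Real.rpow_neg hm'.le]
      have f1 : C ^ (2 - r) ≤ (1 + C) ^ 2 := by
        calc C ^ (2 - r) ≤ (1 + C) ^ (2 - r) := by gcongr; linarith
          _ ≤ (1 + C) ^ (2 : ℝ) := by
              gcongr <;> linarith
          _ = _ := by norm_cast
      have f2 : (d : ℝ) ^ (1 / 2 * (2 - r)) ≤ d := by
        calc (d : ℝ) ^ (1 / 2 * (2 - r)) ≤ (d : ℝ) ^ (1 : ℝ) := by
              gcongr; linarith
          _ = d := Real.rpow_one _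
      have f3 : (m : ℝ) ^ (-(1 / 2 * (2 - r))) = (2 : ℝ) ^ (-(x * (1 - r / 2))) := by
        rw [hmx, ← Real.rpow_mul two_pos.le]
        congr 1
        ring
      rw [f3, ← mul_assoc]
      gcongr
    have e2 : (L * (2 : ℝ) ^ (-(((u + d : ℕ) : ℝ) * (s + 1 / 2 - r⁻¹)))) ^ r ≤
        (1 + L) ^ 2 * (2 : ℝ) ^ (-((u + d) * (r * s + r / 2 - 1))) := by
      rw [Real.mul_rpow hL.le (by positivity), ← Real.rpow_mul two_pos.le]
      have f1 : L ^ r ≤ (1 + L) ^ 2 := by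
        calc L ^ r ≤ (1 + L) ^ r := by gcongr; linarith
          _ ≤ (1 + L) ^ (2 : ℝ) := by gcongr; linarith
          _ = _ := by norm_cast
      have f2 : -(((u + d : ℕ) : ℝ) * (s + 1 / 2 - r⁻¹)) * r =
          -((u + d) * (r * s + r / 2 - 1)) := by
        push_cast
        field_simp
      rw [f2]
      gcongr
    -- Balance of exponents: `m ≥ 2^{u(2s+1)}` and `(2s+1)(1 - r/2) + (rs + r/2 - 1) = 2s` give the
    -- factor `2^{-2su}`. The remaining exponent of `d` is `rs + r/2 - 1`, which exceeds `1/2`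
    -- because `rs > 1`.
    have e3 : (2 : ℝ) ^ (-(x * (1 - r / 2))) * (2 : ℝ) ^ (-((u + d) * (r * s + r / 2 - 1))) ≤
        (2 : ℝ) ^ (-(η * d)) * (2 : ℝ) ^ (-(2 * s * u)) := by
      rw [← Real.rpow_add two_pos, ← Real.rpow_add two_pos]
      refine Real.rpow_le_rpow_of_exponent_le one_le_two ?_
      have g1 : (u : ℝ) * (2 * s + 1) * (1 - r / 2) ≤ x * (1 - r / 2) := by
        gcongr; linarith
      have g2 : η * d ≤ (r * s + r / 2 - 1) * d := by
        gcongr; linarith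
      nlinarith
    calc _ ≤ ((1 + C) ^ 2 * d * (2 : ℝ) ^ (-(x * (1 - r / 2)))) *
          ((1 + L) ^ 2 * (2 : ℝ) ^ (-((u + d) * (r * s + r / 2 - 1)))) := by gcongr
      _ = (1 + C) ^ 2 * (1 + L) ^ 2 * d * ((2 : ℝ) ^ (-(x * (1 - r / 2))) *
          (2 : ℝ) ^ (-((u + d) * (r * s + r / 2 - 1)))) := by ring
      _ ≤ (1 + C) ^ 2 * (1 + L) ^ 2 * d *
          ((2 : ℝ) ^ (-(η * d)) * (2 : ℝ) ^ (-(2 * s * u))) := by gcongr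
      _ = _ := by ring

end Besov

/-! ### Sums over the levels -/

/-- Only `u + d` and `u - d` lie at distance `d` from `u`. Natural subtraction merely adds spurious
nonnegative terms at `0`. -/
theorem tsum_dist_le (F : ℕ → ℝ≥0∞) (u : ℕ) : ∑' j, F (Nat.dist j u) ≤ 2 * ∑' d, F d := by
  have hG : ∀ j, F (Nat.dist j u) ≤
      ∑' d, (if j = u + d then F d else 0) + ∑' d, (if j = u - d then F d else 0) := by
    intro j
    rcases le_total u j with h | h
    · refine le_trans ?_ (le_self_add)
      refine le_trans ?_ (ENNReal.le_tsum (Nat.dist j u))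
      rw [if_pos (by rw [Nat.dist_eq_sub_of_le_right h]; omega)]
    · refine le_trans ?_ (le_add_self)
      refine le_trans ?_ (ENNReal.le_tsum (Nat.dist j u))
      rw [if_pos (by rw [Nat.dist_eq_sub_of_le h]; omega)]
  refine (ENNReal.tsum_le_tsum hG).trans ?_
  rw [ENNReal.tsum_add, ENNReal.tsum_comm, ENNReal.tsum_comm (α := ℕ) (β := ℕ)
    (f := fun j d => if j = u - d then F d else 0), two_mul]
  simp only [tsum_ite_eq, le_refl]

theorem tsum_nat_add_le (F : ℕ → ℝ≥0∞) (τ : ℕ) : ∑' i, F (τ + i) ≤ ∑' j, F j :=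
  ENNReal.tsum_comp_le_tsum_of_injective (add_right_injective τ) F

/-! ### Deviations at the fine levels -/

/-- The logarithm in `2^{j₁} < 2m / log m` cancels `j ≤ log m / log 2`. It keeps `2^{j/2} √(d/m)`
bounded, hence the linear term of the Bernstein bound harmless. -/
theorem two_pow_finestLevel_mul_le {m j : ℕ} (hm : 8 ≤ m) (hj : j ≤ finestLevel m) :
    (2 : ℝ) ^ j * j ≤ 2 / Real.log 2 * m := by
  have hm' : (8 : ℝ) ≤ m := by exact_mod_cast hm
  have hl2 := Real.log_two_gt_d9
  have hlog : 2 ≤ Real.log m := by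
    have h1 : Real.log 8 ≤ Real.log m := Real.log_le_log (by norm_num) hm'
    have h2 : Real.log 8 = 3 * Real.log 2 := by
      rw [show (8 : ℝ) = 2 ^ 3 by norm_num, Real.log_pow]
      norm_num
    linarith
  have hspec := (finestLevel_spec (m := m) (by omega)).2
  have h1 : (2 : ℝ) ^ j ≤ 2 * (m / Real.log m) :=
    (pow_le_pow_right₀ one_le_two hj).trans hspec.le
  have h2 : (2 : ℝ) ^ j ≤ m := by
    refine h1.trans ?_
    rw [mul_div_assoc', div_le_iff₀ (by linarith)]
    nlinarith
  have h3 : (j : ℝ) * Real.log 2 ≤ Real.log m := by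
    rw [← Real.log_pow]
    exact Real.log_le_log (by positivity) h2
  have h4 : (j : ℝ) ≤ Real.log m / Real.log 2 := by
    rwa [le_div_iff₀ (by linarith)]
  calc (2 : ℝ) ^ j * j ≤ (2 * (m / Real.log m)) * (Real.log m / Real.log 2) := by gcongr
    _ = _ := by
        have : Real.log m ≠ 0 := by linarith
        have : Real.log 2 ≠ 0 := by linarith
        field_simp

/-- The Bernstein exponent is at least `1.1 d log 2`. Any factor above 1 would beat the `2^d`
coefficients; `11/10` is what the slack in the condition on `ρ` allows. -/
theorem deviation_exponent_le {B ρ S : ℝ} (hB : 1 ≤ B) (hρ : 0 < ρ) (hS : 0 ≤ S)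
    (hρB : 4 * Real.log 2 ≤ ρ ^ 2 / (8 * B + (8 * ρ / (3 * Real.sqrt 2)) * (S + B)))
    {m j d : ℕ} (hm : 8 ≤ m) (hj : j ≤ finestLevel m) (hd : d ≤ j) :
    11 / 10 * Real.log 2 * d *
      (2 * (2 * B + ((2 : ℝ) ^ ((j : ℝ) / 2) * S + B) * (ρ * Real.sqrt ((d : ℝ) / m) / 2))) ≤
      m * (ρ * Real.sqrt ((d : ℝ) / m) / 2) ^ 2 := by
  have hm' : (8 : ℝ) ≤ m := by exact_mod_cast hm
  have hl2 := Real.log_two_gt_d9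
  have hs2 : (0 : ℝ) < Real.sqrt 2 := by positivity
  have hs2' : Real.sqrt 2 ≤ 1.4143 := by
    rw [Real.sqrt_le_left (by norm_num)]
    norm_num
  have hden : 0 < 8 * B + (8 * ρ / (3 * Real.sqrt 2)) * (S + B) := by positivity
  rw [le_div_iff₀ hden] at hρB
  -- `1.8854` lies just below `8 / (3√2)`, and `0.85 = 1.7 / 2` where `1.7² ≥ 2 / log 2`.
  have hcoef : 1.8854 * ρ ≤ 8 * ρ / (3 * Real.sqrt 2) := by
    rw [le_div_iff₀ (by positivity)]
    nlinarith
  have hw : ((2 : ℝ) ^ ((j : ℝ) / 2) * S + B) * (ρ * Real.sqrt ((d : ℝ) / m) / 2) ≤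
      0.85 * ρ * (S + B) := by
    have h1 : (1 : ℝ) ≤ (2 : ℝ) ^ ((j : ℝ) / 2) :=
      Real.one_le_rpow one_le_two (by positivity)
    have h2 : (2 : ℝ) ^ ((j : ℝ) / 2) * Real.sqrt ((d : ℝ) / m) ≤ 1.7 := by
      have h3 : (2 : ℝ) ^ ((j : ℝ) / 2) = Real.sqrt (2 ^ j) := by
        rw [Real.sqrt_eq_rpow, ← Real.rpow_natCast, ← Real.rpow_mul two_pos.le]
        congr 1
        ring
      rw [h3, ← Real.sqrt_mul (by positivity), Real.sqrt_le_left (by norm_num), mul_div_assoc',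
        div_le_iff₀ (by linarith)]
      calc (2 : ℝ) ^ j * d ≤ 2 ^ j * j := by gcongr
        _ ≤ 2 / Real.log 2 * m := two_pow_finestLevel_mul_le hm hj
        _ ≤ _ := by
            gcongr
            rw [div_le_iff₀ (by linarith)]
            norm_num
            linarith
    have h4 : 0 ≤ Real.sqrt ((d : ℝ) / m) := Real.sqrt_nonneg _
    calc ((2 : ℝ) ^ ((j : ℝ) / 2) * S + B) * (ρ * Real.sqrt ((d : ℝ) / m) / 2)
        ≤ ((2 : ℝ) ^ ((j : ℝ) / 2) * S + (2 : ℝ) ^ ((j : ℝ) / 2) * B) *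
          (ρ * Real.sqrt ((d : ℝ) / m) / 2) := by
          gcongr
          nlinarith
      _ = ((2 : ℝ) ^ ((j : ℝ) / 2) * Real.sqrt ((d : ℝ) / m)) * (ρ * (S + B) / 2) := by ring
      _ ≤ 1.7 * (ρ * (S + B) / 2) := by gcongr
      _ = _ := by ring
  have hsq : (m : ℝ) * (ρ * Real.sqrt ((d : ℝ) / m) / 2) ^ 2 = d * (ρ ^ 2 / 4) := by
    rw [div_pow, mul_pow, Real.sq_sqrt (by positivity)]
    field_simp
    norm_num
  rw [hsq]
  have hK : 0 ≤ ρ * (S + B) := by positivity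
  have key : 11 / 10 * Real.log 2 * (2 * (2 * B + 0.85 * ρ * (S + B))) ≤ ρ ^ 2 / 4 := by
    have h1 : Real.log 2 * (8 * B + 1.8854 * ρ * (S + B)) ≤ ρ ^ 2 / 4 := by
      -- The comparison leaves `4.4 B + 1.87 ρ(S + B)` against `8 B + 1.8854 ρ(S + B)`; the second
      -- coefficient is the tight one.
      have : Real.log 2 * (8 * B + 1.8854 * ρ * (S + B)) ≤
          Real.log 2 * (8 * B + (8 * ρ / (3 * Real.sqrt 2)) * (S + B)) := by gcongr
      linarith
    refine le_trans ?_ h1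
    have h2 : 11 / 10 * (2 * (2 * B + 0.85 * ρ * (S + B))) ≤ 8 * B + 1.8854 * ρ * (S + B) := by
      nlinarith
    calc _ = Real.log 2 * (11 / 10 * (2 * (2 * B + 0.85 * ρ * (S + B)))) := by ring
      _ ≤ _ := by gcongr
  calc _ ≤ 11 / 10 * Real.log 2 * d * (2 * (2 * B + 0.85 * ρ * (S + B))) := by gcongr
    _ = d * (11 / 10 * Real.log 2 * (2 * (2 * B + 0.85 * ρ * (S + B)))) := by ring
    _ ≤ _ := by gcongr

theorem deviation_threshold_le {ψ f : ℝ → ℝ} {B ρ : ℝ} (hB : 1 ≤ B) (hρ : 0 < ρ)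
    (hρB : 4 * Real.log 2 ≤
      ρ ^ 2 / (8 * B + (8 * ρ / (3 * Real.sqrt 2)) * (supNorm ψ + B)))
    (hψ : Measurable ψ) (hf : IsBoundedDensity B f) {m j u k : ℕ} (hm : 8 ≤ m)
    (hj : j ≤ finestLevel m) (hu : u < j)
    (h1 : ∫⁻ x, ENNReal.ofReal (periodized ψ j k x ^ 2) ∂unitMeasure ≤ 1)
    (hsup : ∀ᵐ x, |periodized ψ j k x| ≤ (2 : ℝ) ^ ((j : ℝ) / 2) * supNorm ψ) :
    deviation f (periodized ψ j k) m (threshold ρ m u j) ≤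
      ENNReal.ofReal (2 * ρ ^ 2 / m * (j - u : ℕ) *
        (2 : ℝ) ^ (-(11 / 10 * ((j - u : ℕ) : ℝ)))) := by
  have hS : 0 ≤ supNorm ψ := ENNReal.toReal_nonneg
  have hexp := deviation_exponent_le hB hρ hS hρB hm hj (Nat.sub_le j u)
  have hd : (1 : ℝ) ≤ (j - u : ℕ) := by
    have : 1 ≤ j - u := by omega
    exact_mod_cast this
  have hm' : (8 : ℝ) ≤ m := by exact_mod_cast hm
  have hm0 : (0 : ℝ) < m := by linarith
  set d : ℝ := ((j - u : ℕ) : ℝ) with hddef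
  have htdef : threshold ρ m u j = ρ * Real.sqrt (d / m) := rfl
  rw [htdef]
  set t := ρ * Real.sqrt (d / m) with ht
  have htpos : 0 < t := by positivity
  set S := (2 : ℝ) ^ ((j : ℝ) / 2) * supNorm ψ with hSdef
  have hS0 : 0 ≤ S := by positivity
  have hb : 0 < 2 * B + (S + B) * (t / 2) := by positivity
  have hl2 := Real.log_two_gt_d9
  -- Since `d ≥ 1`, the factor `2.2 d log 2` exceeds 1, so the exponent bound already contains this
  -- condition.
  have hlarge : 2 * B + (S + B) * (t / 2) ≤ m * (t / 2) ^ 2 := by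
    refine le_trans ?_ hexp
    have h3 : 1 ≤ 11 / 10 * Real.log 2 * d * 2 := by nlinarith
    nlinarith
  refine (deviation_le_exp hB hf (by omega) (measurable_periodized hψ j k) h1 hS0 htpos
    (ae_restrict_of_ae hsup) hlarge).trans (ENNReal.ofReal_le_ofReal ?_)
  have hsq : 8 * (t / 2) ^ 2 = 2 * ρ ^ 2 / m * d := by
    rw [ht, div_pow, mul_pow, Real.sq_sqrt (by positivity)]
    field_simp
    norm_num
  rw [hsq]
  gcongr
  rw [Real.rpow_def_of_pos two_pos, Real.exp_le_exp]
  have h4 : 11 / 10 * Real.log 2 * d ≤ m * (t / 2) ^ 2 / (2 * (2 * B + (S + B) * (t / 2))) := by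
    rw [le_div_iff₀ (by positivity)]
    exact hexp
  linarith

/-! ### The balancing level and the rate -/

/-- The level `u` with `2^{u (2s + 1)} ≤ m < 2^{(u + 1) (2s + 1)}`. -/
noncomputable def balanceLevel (s : ℝ) (m : ℕ) : ℕ := ⌊Real.logb 2 m / (2 * s + 1)⌋₊

section Rate

variable {s : ℝ} {m : ℕ}

theorem balanceLevel_mul_le (hs : 0 < s) (hm : 1 ≤ m) :
    (balanceLevel s m : ℝ) * (2 * s + 1) ≤ Real.logb 2 m := by
  have h0 : 0 ≤ Real.logb 2 m := Real.logb_nonneg one_lt_two (by exact_mod_cast hm)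
  rw [← le_div_iff₀ (by positivity)]
  exact Nat.floor_le (by positivity)

theorem rate_eq (hm : 1 ≤ m) :
    (m : ℝ) ^ (-(2 * s) / (2 * s + 1)) = (2 : ℝ) ^ (-(2 * s * (Real.logb 2 m / (2 * s + 1)))) := by
  have hm' : (0 : ℝ) < m := by exact_mod_cast hm
  conv_lhs => rw [← Real.rpow_logb two_pos (by norm_num) hm', ← Real.rpow_mul two_pos.le]
  congr 1
  ring

theorem two_pow_balanceLevel_div_le (hs : 0 < s) (hm : 1 ≤ m) :
    (2 : ℝ) ^ balanceLevel s m / m ≤ (m : ℝ) ^ (-(2 * s) / (2 * s + 1)) := by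
  have hm' : (0 : ℝ) < m := by exact_mod_cast hm
  rw [rate_eq hm]
  have h := balanceLevel_mul_le hs hm
  rw [← le_div_iff₀ (by positivity)] at h
  have h2 : (m : ℝ) = (2 : ℝ) ^ Real.logb 2 m :=
    (Real.rpow_logb two_pos (by norm_num) hm').symm
  set x := Real.logb 2 m with hx
  rw [h2, ← Real.rpow_natCast, ← Real.rpow_sub two_pos]
  refine Real.rpow_le_rpow_of_exponent_le one_le_two ?_
  have h3 : x = (2 * s + 1) * (x / (2 * s + 1)) := by field_simp
  linarith

theorem inv_le_rate (hs : 0 < s) (hm : 1 ≤ m) :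
    1 / (m : ℝ) ≤ (m : ℝ) ^ (-(2 * s) / (2 * s + 1)) := by
  refine le_trans ?_ (two_pow_balanceLevel_div_le hs hm)
  gcongr
  exact one_le_pow₀ one_le_two

/-- Rounding the balancing level down loses a factor `2^{2s}`; the upper bound `N` on the smoothness
makes it a constant. -/
theorem two_rpow_balanceLevel_le {N : ℝ} (hs : 0 < s) (hsN : s ≤ N) (hm : 1 ≤ m) :
    (2 : ℝ) ^ (-(2 * s * balanceLevel s m)) ≤
      (2 : ℝ) ^ (2 * N) * (m : ℝ) ^ (-(2 * s) / (2 * s + 1)) := by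
  rw [rate_eq hm, ← Real.rpow_add two_pos]
  refine Real.rpow_le_rpow_of_exponent_le one_le_two ?_
  have h := (Nat.lt_floor_add_one (Real.logb 2 m / (2 * s + 1))).le
  change _ ≤ (balanceLevel s m : ℝ) + 1 at h
  nlinarith

theorem two_pow_balanceLevel_le (hs : 0 < s) (hm : 1 ≤ m) : 2 ^ balanceLevel s m ≤ m := by
  have hm' : (0 : ℝ) < m := by exact_mod_cast hm
  have h := balanceLevel_mul_le hs hm
  have h2 : (2 : ℝ) ^ balanceLevel s m ≤ m := by
    rw [← Real.rpow_natCast, ← Real.le_logb_iff_rpow_le one_lt_two hm']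
    have : (0 : ℝ) ≤ balanceLevel s m := Nat.cast_nonneg _
    nlinarith
  exact_mod_cast h2

/-- The rate absorbs the bias of truncation at the finest level. -/
theorem exists_two_rpow_finestLevel_le {s₀ : ℝ} (hs₀ : 0 < s₀) (N : ℝ) :
    ∃ K : ℝ, 0 < K ∧ ∀ s κ : ℝ, s₀ ≤ s → s ≤ N → (κ = 2 * s ∨ 1 ≤ κ) → ∀ m : ℕ, 2 ≤ m →
      (2 : ℝ) ^ (-(κ * finestLevel m)) ≤ K * (m : ℝ) ^ (-(2 * s) / (2 * s + 1)) := by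
  -- The bound `log m ≤ m^a / a` absorbs the logarithm in `log m / m`. For `κ = 2s` take `a = δ`, as
  -- `1 - δ = 1/(2s₀+1) ≥ 1/(2s+1)`. For `κ ≥ 1` take `a = ε`, as `ε ≤ 1/(2s+1)`. Both choices are
  -- uniform in `s`.
  set δ : ℝ := 2 * s₀ / (2 * s₀ + 1) with hδ
  have hδ0 : 0 < δ := by positivity
  have hδ1 : δ ≤ 1 := by rw [hδ, div_le_one (by positivity)]; linarith
  set ε : ℝ := 1 / (2 * |N| + 1) with hε
  have hε0 : 0 < ε := by positivity
  refine ⟨(1 / δ) ^ (2 * |N|) + 1 / ε, by positivity, fun s κ hs hsN hκ m hm => ?_⟩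
  have hs0 : 0 < s := hs₀.trans_le hs
  have hm' : (2 : ℝ) ≤ m := by exact_mod_cast hm
  have hm0 : (0 : ℝ) < m := by linarith
  have hlog : 0 < Real.log m := Real.log_pos (by linarith)
  have hNs : s ≤ |N| := hsN.trans (le_abs_self N)
  have hspec := (finestLevel_spec hm).1
  have hbase : ((2 : ℝ) ^ finestLevel m)⁻¹ ≤ Real.log m / m := by
    rw [← inv_div]
    exact inv_anti₀ (by positivity) hspec
  have hJ : ∀ κ : ℝ, (2 : ℝ) ^ (-(κ * finestLevel m)) = (((2 : ℝ) ^ finestLevel m)⁻¹) ^ κ := by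
    intro κ
    rw [Real.inv_rpow (by positivity), ← Real.rpow_neg (by positivity), ← Real.rpow_natCast,
      ← Real.rpow_mul two_pos.le]
    congr 1
    ring
  have hpow : ∀ a : ℝ, 0 < a → Real.log m / m ≤ 1 / a * (m : ℝ) ^ (a - 1) := by
    intro a ha
    rw [div_le_iff₀ hm0, mul_assoc, ← Real.rpow_add_one hm0.ne', sub_add_cancel]
    have := Real.log_le_rpow_div hm0.le ha
    linarith [show (m : ℝ) ^ a / a = 1 / a * (m : ℝ) ^ a by ring]
  have hR : 0 < (m : ℝ) ^ (-(2 * s) / (2 * s + 1)) := by positivity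
  rw [add_mul]
  rcases hκ with rfl | hκ
  · refine le_trans ?_ (le_add_of_nonneg_right (by positivity))
    rw [hJ]
    calc (((2 : ℝ) ^ finestLevel m)⁻¹) ^ (2 * s) ≤ (1 / δ * (m : ℝ) ^ (δ - 1)) ^ (2 * s) := by
          gcongr
          exact hbase.trans (hpow δ hδ0)
      _ = (1 / δ) ^ (2 * s) * (m : ℝ) ^ ((δ - 1) * (2 * s)) := by
          rw [Real.mul_rpow (by positivity) (by positivity), ← Real.rpow_mul hm0.le]
      _ ≤ _ := by
          gcongr ?_ * ?_
          · refine Real.rpow_le_rpow_of_exponent_le ?_ (by linarith)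
            rw [le_div_iff₀ hδ0]
            linarith
          · refine Real.rpow_le_rpow_of_exponent_le (by linarith) ?_
            have h1 : δ - 1 = -(1 / (2 * s₀ + 1)) := by
              rw [hδ]
              field_simp
              ring
            have h2 : 1 / (2 * s + 1) ≤ 1 / (2 * s₀ + 1) := by gcongr
            rw [h1, show -(2 * s) / (2 * s + 1) = -(1 / (2 * s + 1)) * (2 * s) by ring]
            gcongr
  · refine le_trans ?_ (le_add_of_nonneg_left (by positivity))
    have h1 : (2 : ℝ) ^ (-(κ * finestLevel m)) ≤ (2 : ℝ) ^ (-(1 * (finestLevel m : ℝ))) := by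
      refine Real.rpow_le_rpow_of_exponent_le one_le_two ?_
      gcongr
    refine h1.trans ?_
    rw [hJ, Real.rpow_one]
    refine (hbase.trans (hpow ε hε0)).trans ?_
    gcongr
    · linarith
    · rw [show -(2 * s) / (2 * s + 1) = 1 / (2 * s + 1) - 1 by field_simp; ring]
      rw [hε]
      gcongr

end Rate

/-! ### Summing the contributions of the levels -/

/-- The summable profile that controls the contributions of the levels on both sides of the
balancing level and above the finest level. -/
noncomputable def profile (η : ℝ) (d : ℕ) : ℝ := (d + 1) * (2 : ℝ) ^ (-(η * d))

theorem profile_nonneg (η : ℝ) (d : ℕ) : 0 ≤ profile η d := by unfold profile; positivity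

theorem rpow_le_profile (η : ℝ) (d : ℕ) : (2 : ℝ) ^ (-(η * d)) ≤ profile η d := by
  unfold profile
  have h : (0 : ℝ) < (2 : ℝ) ^ (-(η * d)) := by positivity
  have hd : (0 : ℝ) ≤ d := Nat.cast_nonneg d
  nlinarith

theorem mul_rpow_le_profile (η : ℝ) (d : ℕ) : d * (2 : ℝ) ^ (-(η * d)) ≤ profile η d := by
  unfold profile
  gcongr
  linarith

theorem summable_profile {η : ℝ} (hη : 0 < η) : Summable (profile η) := by
  have hr : ‖(2 : ℝ) ^ (-η)‖ < 1 := by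
    rw [Real.norm_eq_abs, abs_of_pos (by positivity)]
    exact Real.rpow_lt_one_of_one_lt_of_neg one_lt_two (by linarith)
  have h1 := summable_pow_mul_geometric_of_norm_lt_one 1 hr
  have h0 := summable_pow_mul_geometric_of_norm_lt_one 0 hr
  refine (h1.add h0).congr fun d => ?_
  rw [profile, ← Real.rpow_natCast ((2 : ℝ) ^ (-η)) d, ← Real.rpow_mul two_pos.le, neg_mul]
  ring

theorem tsum_ofReal_profile_dist_le {η c : ℝ} (hη : 0 < η) (hc : 0 ≤ c) (u τ : ℕ) :
    ∑' i, ENNReal.ofReal (c * profile η (Nat.dist (τ + i) u)) ≤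
      ENNReal.ofReal (2 * (c * ∑' d, profile η d)) := by
  refine (tsum_nat_add_le (fun j => ENNReal.ofReal (c * profile η (Nat.dist j u))) τ).trans ?_
  refine (tsum_dist_le (fun d => ENNReal.ofReal (c * profile η d)) u).trans (le_of_eq ?_)
  rw [← ENNReal.ofReal_tsum_of_nonneg (fun d => mul_nonneg hc (profile_nonneg η d))
    ((summable_profile hη).mul_left c), tsum_mul_left, ENNReal.ofReal_mul zero_le_two]
  simp

theorem tsum_ite_lt_le (c : ℝ≥0∞) (J τ : ℕ) :
    ∑' i, (if τ + i < J then c else 0) ≤ J * c := by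
  refine (tsum_nat_add_le (fun j => if j < J then c else 0) τ).trans (le_of_eq ?_)
  rw [tsum_eq_sum (s := Finset.range J) fun j hj => if_neg (by simpa using hj)]
  rw [Finset.sum_congr rfl fun j hj => if_pos (Finset.mem_range.1 hj), Finset.sum_const,
    Finset.card_range, nsmul_eq_mul]

theorem sum_range_two_pow_le {j : ℕ} {g : ℕ → ℝ≥0∞} {x : ℝ}
    (h : ∀ k < 2 ^ j, g k ≤ ENNReal.ofReal x) :
    ∑ k ∈ Finset.range (2 ^ j), g k ≤ ENNReal.ofReal (2 ^ j * x) := by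
  refine (Finset.sum_le_sum fun k hk => h k (Finset.mem_range.1 hk)).trans (le_of_eq ?_)
  rw [Finset.sum_const, Finset.card_range, nsmul_eq_mul, ENNReal.ofReal_mul (by positivity),
    ENNReal.ofReal_pow zero_le_two]
  simp

/-! ### Bounds for a level below the balancing level, between it and the finest one, and beyond. -/

section Level

variable {φ ψ f : ℝ → ℝ} {τ : ℕ} {B ρ C₁ C₂ s L : ℝ} {p q : ℝ≥0∞} {m : ℕ}

/-- The threshold is zero here, so the bias term vanishes and only the variance `2^j B / m =
2^{-(u-j)} (2^u B / m)` is left. -/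
theorem levelBound_le_of_le_balanceLevel (hwav : IsPeriodizedWaveletBasis φ ψ τ) (hB : 1 ≤ B)
    (hC₁ : 0 < C₁) (hf : IsBoundedDensity B f) (hs : 0 < s) (hm : 1 ≤ m) {η : ℝ} (hη : η ≤ 1)
    {j : ℕ} (hτ : τ ≤ j) (hj : j ≤ finestLevel m) (hu : j ≤ balanceLevel s m) :
    levelBound ψ f C₁ C₂ (threshold ρ m (balanceLevel s m)) m j ≤
      ENNReal.ofReal (C₁ * B * (m : ℝ) ^ (-(2 * s) / (2 * s + 1)) *
        profile η (Nat.dist j (balanceLevel s m))) := by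
  set u := balanceLevel s m with hudef
  have hthr : threshold ρ m u j = 0 := by simp [threshold, Nat.sub_eq_zero_of_le hu]
  have hdev : ∑ k ∈ Finset.range (2 ^ j), deviation f (periodized ψ j k) m 0 ≤
      ENNReal.ofReal (2 ^ j * (B / m)) := sum_range_two_pow_le fun k hk =>
    deviation_le (by linarith) hf (by omega) (measurable_periodized hwav.measurable_mother j k)
      (hwav.lintegral_mother_sq hτ hk).le 0
  have hmin : ∀ k, ENNReal.ofReal ((min |coeff f (periodized ψ j k)| (C₂ * 0)) ^ 2) = 0 := by
    intro k
    rw [mul_zero, min_eq_right (abs_nonneg _)]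
    simp
  rw [levelBound, if_pos hj, hthr]
  simp_rw [hmin]
  rw [Finset.sum_const_zero, zero_add]
  calc _ ≤ ENNReal.ofReal C₁ * ENNReal.ofReal (2 ^ j * (B / m)) := by gcongr
    _ = ENNReal.ofReal (C₁ * (2 ^ j * (B / m))) := (ENNReal.ofReal_mul hC₁.le).symm
    _ ≤ _ := by
      refine ENNReal.ofReal_le_ofReal ?_
      rw [Nat.dist_eq_sub_of_le hu]
      have h1 : (2 : ℝ) ^ j = 2 ^ u * (2 : ℝ) ^ (-((u - j : ℕ) : ℝ)) := by
        rw [← Real.rpow_natCast, ← Real.rpow_natCast, ← Real.rpow_add two_pos]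
        congr 1
        push_cast [Nat.cast_sub hu]
        ring
      have h2 : (2 : ℝ) ^ (-((u - j : ℕ) : ℝ)) ≤ profile η (u - j) := by
        refine le_trans (Real.rpow_le_rpow_of_exponent_le one_le_two ?_) (rpow_le_profile η (u - j))
        have : (0 : ℝ) ≤ (u - j : ℕ) := Nat.cast_nonneg _
        nlinarith
      have h3 := two_pow_balanceLevel_div_le hs hm
      rw [← hudef] at h3
      calc C₁ * (2 ^ j * (B / m)) =
            C₁ * B * (2 ^ u / m) * (2 : ℝ) ^ (-((u - j : ℕ) : ℝ)) := by rw [h1]; ring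
        _ ≤ _ := by gcongr

/-- Interpolation bounds the bias and Bernstein the deviations. Below `J` the periodized translates
may overlap, so the variance bound is used there; these finitely many levels cost `O(1/m)` each. -/
theorem levelBound_le_of_balanceLevel_lt (hwav : IsPeriodizedWaveletBasis φ ψ τ) (hB : 1 ≤ B)
    (hρ : 0 < ρ) (hρB : 4 * Real.log 2 ≤
      ρ ^ 2 / (8 * B + (8 * ρ / (3 * Real.sqrt 2)) * (supNorm ψ + B)))
    (hC₁ : 0 < C₁) (hC₂ : 0 < C₂) (hf : IsBoundedDensity B f) (hL : 0 < L)
    (hp : 1 ≤ p) (hq : 1 ≤ q) (hps : (p⁻¹).toReal < s) (hfb : f ∈ besovBall φ ψ τ s p q L)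
    {N : ℝ} (hsN : s ≤ N) (hm : 8 ≤ m) {η : ℝ} (hη : η ≤ 2 * s) (hη' : η ≤ 1 / 10) {J : ℕ}
    (hJ : ∀ j, J ≤ j → ∀ k, ∀ᵐ x, |periodized ψ j k x| ≤ (2 : ℝ) ^ ((j : ℝ) / 2) * supNorm ψ)
    {j : ℕ} (hτ : τ ≤ j) (hj : j ≤ finestLevel m) (hu : balanceLevel s m < j) :
    levelBound ψ f C₁ C₂ (threshold ρ m (balanceLevel s m)) m j ≤
      ENNReal.ofReal (C₁ * ((1 + C₂ * ρ) ^ 2 * (1 + L) ^ 2 * (2 : ℝ) ^ (2 * N) + 2 * ρ ^ 2) *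
          (m : ℝ) ^ (-(2 * s) / (2 * s + 1)) * profile η (Nat.dist j (balanceLevel s m))) +
        if j < J then ENNReal.ofReal (C₁ * 2 ^ J * B * (m : ℝ) ^ (-(2 * s) / (2 * s + 1)))
        else 0 := by
  have hs : 0 < s := ENNReal.toReal_nonneg.trans_lt hps
  have hm1 : 1 ≤ m := by omega
  have hbal := balanceLevel_mul_le hs hm1
  have hR1 := two_pow_balanceLevel_div_le hs hm1
  have hR2 := two_rpow_balanceLevel_le hs hsN hm1
  have hR3 := inv_le_rate hs hm1
  set u := balanceLevel s m with hudef
  set R := (m : ℝ) ^ (-(2 * s) / (2 * s + 1)) with hRdef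
  have hR0 : 0 ≤ R := by positivity
  obtain ⟨d, rfl⟩ := Nat.exists_eq_add_of_le hu.le
  have hd : 1 ≤ d := by omega
  have hdist : Nat.dist (u + d) u = d := by
    rw [Nat.dist_eq_sub_of_le_right (by omega)]
    omega
  have hsub : u + d - u = d := by omega
  rw [hdist]
  set W := profile η d with hW
  have hW0 : 0 ≤ W := profile_nonneg η d
  have hWd : (d : ℝ) * (2 : ℝ) ^ (-(η * d)) ≤ W := mul_rpow_le_profile η d
  have hthr : threshold ρ m u (u + d) = ρ * Real.sqrt ((d : ℝ) / m) := by
    rw [threshold, hsub]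
  have hmin : ∑ k ∈ Finset.range (2 ^ (u + d)),
      ENNReal.ofReal ((min |coeff f (periodized ψ (u + d) k)|
        (C₂ * threshold ρ m u (u + d))) ^ 2) ≤
      ENNReal.ofReal ((1 + C₂ * ρ) ^ 2 * (1 + L) ^ 2 * (2 : ℝ) ^ (2 * N) * R * W) := by
    rw [← ENNReal.ofReal_sum_of_nonneg fun _ _ => sq_nonneg _]
    refine ENNReal.ofReal_le_ofReal ?_
    rw [hthr, ← mul_assoc]
    refine (sum_min_coeff_sq_le hL hp hq hps hfb hη (by linarith) (by positivity)
      (by omega) hd hbal hτ).trans ?_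
    calc _ ≤ (1 + C₂ * ρ) ^ 2 * (1 + L) ^ 2 * W * ((2 : ℝ) ^ (2 * N) * R) := by gcongr
      _ = _ := by ring
  have hdev : ∑ k ∈ Finset.range (2 ^ (u + d)),
      deviation f (periodized ψ (u + d) k) m (threshold ρ m u (u + d)) ≤
      ENNReal.ofReal (2 * ρ ^ 2 * R * W) +
        if u + d < J then ENNReal.ofReal (2 ^ J * B * R) else 0 := by
    split_ifs with h
    · refine le_trans ?_ le_add_self
      refine (sum_range_two_pow_le fun k hk => deviation_le (by linarith) hf (by omega)
        (measurable_periodized hwav.measurable_mother _ k)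
        (hwav.lintegral_mother_sq hτ hk).le _).trans (ENNReal.ofReal_le_ofReal ?_)
      calc (2 : ℝ) ^ (u + d) * (B / m) ≤ 2 ^ J * (B / m) := by
            gcongr
            exact one_le_two
        _ = 2 ^ J * B * (1 / m) := by ring
        _ ≤ _ := by gcongr
    · rw [add_zero]
      refine (sum_range_two_pow_le fun k hk => deviation_threshold_le hB hρ hρB
        hwav.measurable_mother hf hm hj hu (hwav.lintegral_mother_sq hτ hk).le
        (hJ _ (not_lt.1 h) k)).trans (ENNReal.ofReal_le_ofReal ?_)
      rw [hsub]
      -- The surplus over the number of coefficients is `2^{-d/10}`, whence `η ≤ 1/10`.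
      have h1 : (2 : ℝ) ^ d * (2 : ℝ) ^ (-(11 / 10 * (d : ℝ))) ≤ (2 : ℝ) ^ (-(η * d)) := by
        rw [← Real.rpow_natCast, ← Real.rpow_add two_pos]
        refine Real.rpow_le_rpow_of_exponent_le one_le_two ?_
        have : (0 : ℝ) ≤ d := Nat.cast_nonneg _
        nlinarith
      calc (2 : ℝ) ^ (u + d) * (2 * ρ ^ 2 / m * d * (2 : ℝ) ^ (-(11 / 10 * (d : ℝ)))) =
            2 * ρ ^ 2 * (2 ^ u / m) * (d * ((2 : ℝ) ^ d * (2 : ℝ) ^ (-(11 / 10 * (d : ℝ))))) := by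
            rw [pow_add]
            ring
        _ ≤ 2 * ρ ^ 2 * R * (d * (2 : ℝ) ^ (-(η * d))) := by gcongr
        _ ≤ _ := by gcongr
  rw [levelBound, if_pos hj]
  calc _ ≤ ENNReal.ofReal C₁ * (ENNReal.ofReal
        ((1 + C₂ * ρ) ^ 2 * (1 + L) ^ 2 * (2 : ℝ) ^ (2 * N) * R * W) +
        (ENNReal.ofReal (2 * ρ ^ 2 * R * W) +
        if u + d < J then ENNReal.ofReal (2 ^ J * B * R) else 0)) := by gcongr
    _ = _ := by
      rw [← add_assoc, ← ENNReal.ofReal_add (by positivity) (by positivity), mul_add,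
        ← ENNReal.ofReal_mul hC₁.le, mul_ite, mul_zero, ← ENNReal.ofReal_mul hC₁.le]
      congr 2
      · ring
      · congr 1
        ring

/-- The energy decays geometrically from the finest level, where it is already of the order of the
rate. -/
theorem levelBound_le_of_finestLevel_lt {κ K η : ℝ} (hηκ : η ≤ κ)
    (hκ : ∀ j, τ ≤ j → ∑ k ∈ Finset.range (2 ^ j), coeff f (periodized ψ j k) ^ 2 ≤
        L ^ 2 * (2 : ℝ) ^ (-(κ * j)))
    (hK : (2 : ℝ) ^ (-(κ * finestLevel m)) ≤ K * (m : ℝ) ^ (-(2 * s) / (2 * s + 1)))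
    {thr : ℕ → ℝ} {j : ℕ} (hτ : τ ≤ j) (hj : finestLevel m < j) :
    levelBound ψ f C₁ C₂ thr m j ≤
      ENNReal.ofReal (L ^ 2 * K * (m : ℝ) ^ (-(2 * s) / (2 * s + 1)) *
        profile η (Nat.dist j (finestLevel m))) := by
  rw [levelBound, if_neg (by omega), ← ENNReal.ofReal_sum_of_nonneg fun _ _ => sq_nonneg _]
  refine ENNReal.ofReal_le_ofReal ((hκ j hτ).trans ?_)
  rw [Nat.dist_eq_sub_of_le_right hj.le]
  have h1 : (2 : ℝ) ^ (-(κ * j)) =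
      (2 : ℝ) ^ (-(κ * finestLevel m)) * (2 : ℝ) ^ (-(κ * (j - finestLevel m : ℕ))) := by
    rw [← Real.rpow_add two_pos]
    congr 1
    push_cast [Nat.cast_sub hj.le]
    ring
  have h2 : (2 : ℝ) ^ (-(κ * (j - finestLevel m : ℕ))) ≤ profile η (j - finestLevel m) := by
    refine le_trans (Real.rpow_le_rpow_of_exponent_le one_le_two ?_) (rpow_le_profile _ _)
    gcongr
  calc L ^ 2 * (2 : ℝ) ^ (-(κ * j)) ≤ L ^ 2 * ((K * (m : ℝ) ^ (-(2 * s) / (2 * s + 1))) *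
        profile η (j - finestLevel m)) := by
        rw [h1]
        have h3 := (Real.rpow_pos_of_pos two_pos (-(κ * finestLevel m))).le.trans hK
        gcongr
    _ = _ := by ring

end Level

/-- The thresholded estimator that starts thresholding at the balancing level attains the rate. -/
theorem exists_lintegral_thresholdedEstimator_le {φ ψ : ℝ → ℝ} {τ : ℕ}
    (hwav : IsPeriodizedWaveletBasis φ ψ τ) {Υ : ℝ → ℝ → ℝ} (hΥ : IsThresholdingRule Υ)
    {B : ℝ} (hB : 1 ≤ B) {L : ℝ} (hL : 0 < L) {ρ : ℝ} (hρ : 0 < ρ)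
    (hρB : 4 * Real.log 2 ≤
      ρ ^ 2 / (8 * B + (8 * ρ / (3 * Real.sqrt 2)) * (supNorm ψ + B)))
    (N : ℝ) {s₀ : ℝ} (hs₀ : 0 < s₀) :
    ∃ K : ℝ, 0 < K ∧ ∀ p q : ℝ≥0∞, 1 ≤ p → 1 ≤ q →
      ∀ s : ℝ, s₀ ≤ s → (p⁻¹).toReal < s → s ≤ N →
      ∀ n : ℕ, 8 ≤ trainSize n → ∀ f, IsBoundedDensity B f → f ∈ besovBall φ ψ τ s p q L →
        ∫⁻ X, ∫⁻ x, ENNReal.ofReal ((thresholdedEstimator φ ψ τ Υ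
          (threshold ρ (trainSize n) (balanceLevel s (trainSize n))) (trainSample X) x - f x) ^ 2)
          ∂unitMeasure ∂(Measure.pi fun _ : Fin n => densityLaw f) ≤
        ENNReal.ofReal (K * (trainSize n : ℝ) ^ (-(2 * s) / (2 * s + 1))) := by
  obtain ⟨C₁, hC₁, C₂, hC₂, hbound⟩ := hΥ.bound
  obtain ⟨J, hJ⟩ := exists_level_abs_periodized_le hwav.compact_mother hwav.bounded_mother
  obtain ⟨Kt, hKt, htail⟩ := exists_two_rpow_finestLevel_le hs₀ N
  -- One exponent for all regimes: at most `2s` for the bias, at most `κ` for the tail, at most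
  -- `1/10` for the deviations, and depending on `s₀` only.
  set η : ℝ := min (2 * s₀) (1 / 10) with hη
  have hη0 : 0 < η := lt_min (by positivity) (by norm_num)
  have hη1 : η ≤ 2 * s₀ := min_le_left _ _
  have hη2 : η ≤ 1 / 10 := min_le_right _ _
  set T := ∑' d, profile η d with hT
  have hT0 : 0 ≤ T := tsum_nonneg (profile_nonneg η)
  set Ka := C₁ * B + C₁ * ((1 + C₂ * ρ) ^ 2 * (1 + L) ^ 2 * (2 : ℝ) ^ (2 * N) + 2 * ρ ^ 2)
    with hKa
  have hKa0 : 0 < Ka := by positivity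
  refine ⟨2 ^ τ * B + (2 * (Ka * T) + J * (C₁ * 2 ^ J * B) + 2 * (L ^ 2 * Kt * T)), by positivity,
    fun p q hp hq s hs hps hsN n hm f hf hfb => ?_⟩
  have hs0 : 0 < s := hs₀.trans_le hs
  have hthr : ∀ j, 0 ≤ threshold ρ (trainSize n) (balanceLevel s (trainSize n)) j := fun j => by
    unfold threshold
    positivity
  refine (lintegral_thresholdedEstimator_le hwav hC₁ hbound (by linarith) hf (by omega)
    hthr).trans ?_
  set m := trainSize n with hmdef
  have hm1 : 1 ≤ m := by omega
  set R := (m : ℝ) ^ (-(2 * s) / (2 * s + 1)) with hR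
  have hR0 : 0 ≤ R := by positivity
  obtain ⟨κ, hκ, henergy⟩ := exists_sum_coeff_sq_le hL hp hq hps hfb
  have hηκ : η ≤ κ := by
    rcases hκ with h | h <;> linarith
  -- Adding the bounds of all regimes avoids splitting the series; each summand is summable on its
  -- own over all levels.
  have hlevel : ∀ i : ℕ, levelBound ψ f C₁ C₂ (threshold ρ m (balanceLevel s m)) m (τ + i) ≤
      ENNReal.ofReal (Ka * R * profile η (Nat.dist (τ + i) (balanceLevel s m))) +
        (if τ + i < J then ENNReal.ofReal (C₁ * 2 ^ J * B * R) else 0) +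
        ENNReal.ofReal (L ^ 2 * Kt * R * profile η (Nat.dist (τ + i) (finestLevel m))) := by
    intro i
    have hprof := profile_nonneg η (Nat.dist (τ + i) (balanceLevel s m))
    rcases lt_or_ge (finestLevel m) (τ + i) with h | h
    · exact (levelBound_le_of_finestLevel_lt hηκ henergy (htail s κ hs hsN hκ m (by omega))
        (by omega) h).trans le_add_self
    · refine le_trans ?_ le_self_add
      rcases le_or_gt (τ + i) (balanceLevel s m) with h' | h'
      · refine (levelBound_le_of_le_balanceLevel hwav hB hC₁ hf hs0 hm1 (η := η) (by linarith)
          (by omega) h h').trans (le_trans (ENNReal.ofReal_le_ofReal ?_) le_self_add)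
        gcongr
        exact le_add_of_nonneg_right (by positivity)
      · refine (levelBound_le_of_balanceLevel_lt hwav hB hρ hρB hC₁ hC₂ hf hL hp hq hps hfb hsN hm
          (by linarith) hη2 hJ (by omega) h h').trans ?_
        gcongr
        exact le_add_of_nonneg_left (by positivity)
  calc _ ≤ ENNReal.ofReal (2 ^ τ * B * R) +
        (ENNReal.ofReal (2 * (Ka * R * T)) + J * ENNReal.ofReal (C₁ * 2 ^ J * B * R) +
          ENNReal.ofReal (2 * (L ^ 2 * Kt * R * T))) := by
        refine add_le_add (ENNReal.ofReal_le_ofReal ?_)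
          ((ENNReal.tsum_le_tsum hlevel).trans ?_)
        · have := inv_le_rate hs0 hm1
          calc (2 : ℝ) ^ τ * (B / m) = 2 ^ τ * B * (1 / m) := by ring
            _ ≤ _ := by gcongr
        · rw [ENNReal.tsum_add, ENNReal.tsum_add]
          gcongr
          · exact tsum_ofReal_profile_dist_le hη0 (by positivity) _ _
          · exact tsum_ite_lt_le _ _ _
          · exact tsum_ofReal_profile_dist_le hη0 (by positivity) _ _
    _ = _ := by
        rw [← ENNReal.ofReal_natCast, ← ENNReal.ofReal_mul (by positivity),
          ← ENNReal.ofReal_add (by positivity) (by positivity),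
          ← ENNReal.ofReal_add (by positivity) (by positivity),
          ← ENNReal.ofReal_add (by positivity) (by positivity)]
        congr 1
        ring

/-! ### Sample sizes -/

section SampleSize

variable {n : ℕ}

theorem learnSize_pos (hn : 2 ≤ n) : 0 < learnSize n := by
  have hn' : (2 : ℝ) ≤ n := by exact_mod_cast hn
  exact Nat.ceil_pos.2 (div_pos (by linarith) (Real.log_pos (by linarith)))

theorem three_le_log (hn : 32 ≤ n) : 3 ≤ Real.log n := by
  have hn' : (32 : ℝ) ≤ n := by exact_mod_cast hn
  have h1 : Real.log 32 ≤ Real.log n := Real.log_le_log (by norm_num) hn'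
  have h2 : Real.log 32 = 5 * Real.log 2 := by
    rw [show (32 : ℝ) = 2 ^ 5 by norm_num, Real.log_pow]
    norm_num
  linarith [Real.log_two_gt_d9]

theorem two_mul_learnSize_le (hn : 32 ≤ n) : 2 * learnSize n ≤ n := by
  have hn' : (32 : ℝ) ≤ n := by exact_mod_cast hn
  have hlog := three_le_log hn
  have h1 : (n : ℝ) / Real.log n ≤ n / 3 := by gcongr
  have h2 := (Nat.ceil_lt_add_one (a := (n : ℝ) / Real.log n) (by positivity)).le
  change (learnSize n : ℝ) ≤ _ at h2
  have h3 : (2 : ℝ) * learnSize n ≤ n := by linarith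
  exact_mod_cast h3

theorem rate_trainSize_le (hn : 32 ≤ n) {s : ℝ} (hs : 0 < s) :
    (trainSize n : ℝ) ^ (-(2 * s) / (2 * s + 1)) ≤ 2 * (n : ℝ) ^ (-(2 * s) / (2 * s + 1)) := by
  have hn' : (32 : ℝ) ≤ n := by exact_mod_cast hn
  have h1 : n ≤ 2 * trainSize n := by
    have := two_mul_learnSize_le hn
    unfold trainSize
    omega
  have h2 : (n : ℝ) / 2 ≤ trainSize n := by
    have : (n : ℝ) ≤ 2 * trainSize n := by exact_mod_cast h1
    linarith
  set a := 2 * s / (2 * s + 1) with ha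
  have ha1 : a ≤ 1 := by rw [ha, div_le_one (by positivity)]; linarith
  rw [neg_div, ← ha]
  calc (trainSize n : ℝ) ^ (-a) ≤ ((n : ℝ) / 2) ^ (-a) :=
        Real.rpow_le_rpow_of_nonpos (by linarith) h2 (by simp only [neg_nonpos]; positivity)
    _ = 2 ^ a * (n : ℝ) ^ (-a) := by
        rw [Real.div_rpow (by positivity) zero_le_two, Real.rpow_neg two_pos.le, div_inv_eq_mul,
          mul_comm]
    _ ≤ _ := by
        gcongr
        calc (2 : ℝ) ^ a ≤ 2 ^ (1 : ℝ) := Real.rpow_le_rpow_of_exponent_le one_le_two ha1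
          _ = 2 := Real.rpow_one 2

theorem inv_le_rate_of_le (hn : 1 ≤ n) {s N ε : ℝ} (hs : 0 < s) (hsN : s ≤ N)
    (hε : ε ≤ 1 / (2 * N + 1)) :
    (n : ℝ) ^ (ε - 1) ≤ (n : ℝ) ^ (-(2 * s) / (2 * s + 1)) := by
  have hn' : (1 : ℝ) ≤ n := by exact_mod_cast hn
  refine Real.rpow_le_rpow_of_exponent_le hn' ?_
  rw [show -(2 * s) / (2 * s + 1) = 1 / (2 * s + 1) - 1 by field_simp; ring]
  have h1 : 1 / (2 * N + 1) ≤ 1 / (2 * s + 1) := by gcongr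
  linarith

/-- The price of aggregation is negligible with respect to the rate. -/
theorem card_indexSet_div_learnSize_le (hn : 32 ≤ n) {s N : ℝ} (hs : 0 < s) (hsN : s ≤ N) :
    ((indexSet n).card : ℝ) / learnSize n ≤
      2 * (2 * (2 * N + 1)) ^ 2 * (n : ℝ) ^ (-(2 * s) / (2 * s + 1)) := by
  have hn' : (32 : ℝ) ≤ n := by exact_mod_cast hn
  have hlog := three_le_log hn
  have hN : 0 < N := hs.trans_le hsN
  have hl2 := Real.log_two_gt_d9
  have hcard : ((indexSet n).card : ℝ) ≤ 2 * Real.log n := by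
    rw [indexSet, Finset.card_range]
    have h1 : (2 : ℝ) ^ Nat.log 2 n ≤ n := by
      have h0 : n ≠ 0 := by omega
      exact_mod_cast Nat.pow_log_le_self 2 h0
    have h2 := Real.log_le_log (by positivity) h1
    rw [Real.log_pow] at h2
    have h3 : (0 : ℝ) ≤ Nat.log 2 n := Nat.cast_nonneg _
    push_cast
    nlinarith
  have hl : (n : ℝ) / Real.log n ≤ learnSize n := Nat.le_ceil _
  -- Half of `1/(2N+1)`, because the logarithm occurs squared: once from the number of candidates,
  -- once from the size of the learning sample.
  set ε : ℝ := 1 / (2 * (2 * N + 1)) with hε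
  have hε0 : 0 < ε := by positivity
  have hlog2 : Real.log n ≤ (n : ℝ) ^ ε / ε := Real.log_le_rpow_div (by positivity) hε0
  calc ((indexSet n).card : ℝ) / learnSize n ≤ (2 * Real.log n) / (n / Real.log n) := by
        gcongr
    _ = 2 * Real.log n ^ 2 / n := by field_simp
    _ ≤ 2 * ((n : ℝ) ^ ε / ε) ^ 2 / n := by gcongr
    _ = 2 * (1 / ε) ^ 2 * (n : ℝ) ^ (2 * ε - 1) := by
        rw [Real.rpow_sub_one (by positivity), two_mul ε, Real.rpow_add (by positivity)]
        ring
    _ ≤ 2 * (1 / ε) ^ 2 * (n : ℝ) ^ (-(2 * s) / (2 * s + 1)) := by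
        refine mul_le_mul_of_nonneg_left ?_ (by positivity)
        refine (inv_le_rate_of_le (n := n) (N := N) (by omega) hs hsN (le_of_eq ?_))
        rw [hε]
        field_simp
    _ = _ := by rw [hε, one_div_one_div]

/-- From `2^u ≤ m ≤ n`: the level suited to the unknown smoothness is always among the candidates,
which is the source of adaptivity. -/
theorem balanceLevel_mem_indexSet {s : ℝ} (hs : 0 < s) (hm : 1 ≤ trainSize n) :
    balanceLevel s (trainSize n) ∈ indexSet n := by
  have h := two_pow_balanceLevel_le hs hm
  have h2 : 2 ^ balanceLevel s (trainSize n) ≤ n := h.trans (Nat.sub_le _ _)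
  rw [indexSet, Finset.mem_range]
  exact Nat.lt_succ_of_le (Nat.le_log_of_pow_le one_lt_two h2)

end SampleSize

end MultiThreshold

/-! ### The theorem: oracle inequality at the balancing level. -/

theorem mainTheorem4 (φ ψ : ℝ → ℝ) (τ : ℕ)
    (hwav : MultiThreshold.IsPeriodizedWaveletBasis φ ψ τ)
    (Υ : ℝ → ℝ → ℝ) (hΥ : MultiThreshold.IsThresholdingRule Υ)
    (B : ℝ) (hB : 1 ≤ B) (L : ℝ) (hL : 0 < L)
    (ρ : ℝ) (hρ : 0 < ρ)
    (hρB : 4 * Real.log 2 ≤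
      ρ ^ 2 / (8 * B + (8 * ρ / (3 * Real.sqrt 2)) * (MultiThreshold.supNorm ψ + B)))
    (N : ℝ) (s₀ : ℝ) (hs₀ : 0 < s₀) :
    ∃ C : ℝ, 0 < C ∧ ∀ p q : ℝ≥0∞, 1 ≤ p → 1 ≤ q →
      ∀ s : ℝ, s₀ ≤ s → (p⁻¹).toReal < s → s ≤ N →
      ∀ n : ℕ, 6 ≤ n →
        (⨆ f ∈ {f : ℝ → ℝ | MultiThreshold.IsBoundedDensity B f} ∩
              MultiThreshold.besovBall φ ψ τ s p q L,
            MultiThreshold.risk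
              (n := n) (MultiThreshold.multiThresholdEstimator φ ψ τ Υ B ρ) f)
          ≤ ENNReal.ofReal (C * (n : ℝ) ^ (-(2 * s) / (2 * s + 1))) := by
  obtain ⟨K, hK, hthr⟩ := MultiThreshold.exists_lintegral_thresholdedEstimator_le hwav hΥ hB hL hρ
    hρB N hs₀
  have hB0 : 0 < B := by linarith
  set D : ℝ := (2 + 32 * B) * (2 * (2 * (2 * N + 1)) ^ 2) with hD
  have hD0 : 0 ≤ D := by positivity
  -- For `n < 32` the trivial bound `B²` is enough, since the rate is at least `1/n ≥ 1/32`. For `n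
  -- ≥ 32`, `3 (K · 2)` is the oracle factor times the candidate's risk, the 2 coming from `m ≥
  -- n/2`, and `D` is the price of aggregation.
  refine ⟨32 * B ^ 2 + (3 * (K * 2) + D), by positivity, fun p q hp hq s hs hps hsN n hn => ?_⟩
  have hs0 : 0 < s := hs₀.trans_le hs
  have hR0 : 0 ≤ (n : ℝ) ^ (-(2 * s) / (2 * s + 1)) := by positivity
  refine iSup₂_le fun f hf => ?_
  obtain ⟨hfd, hfb⟩ := hf
  change MultiThreshold.IsBoundedDensity B f at hfd
  rcases lt_or_ge n 32 with hn32 | hn32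
  · refine (MultiThreshold.risk_multiThresholdEstimator_le_sq hB0.le ρ hfd n).trans
      (ENNReal.ofReal_le_ofReal ?_)
    have h1 := MultiThreshold.inv_le_rate hs0 (m := n) (by omega)
    have h2 : (1 : ℝ) / 32 ≤ 1 / n := by
      have h3 : (n : ℝ) ≤ 32 := by exact_mod_cast hn32.le
      have h4 : (0 : ℝ) < n := by exact_mod_cast (by omega : 0 < n)
      gcongr
    have h5 : 0 ≤ (3 * (K * 2) + D) * (n : ℝ) ^ (-(2 * s) / (2 * s + 1)) := by positivity
    nlinarith [sq_nonneg B]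
  · have hln := MultiThreshold.two_mul_learnSize_le hn32
    have hm : 8 ≤ MultiThreshold.trainSize n := by
      unfold MultiThreshold.trainSize
      omega
    have hl := MultiThreshold.learnSize_pos (n := n) (by omega)
    refine (MultiThreshold.risk_multiThresholdEstimator_le hwav.measurable_father
      hwav.measurable_mother hB0 ρ hfd (by omega) hl
      (MultiThreshold.balanceLevel_mem_indexSet hs0 (by omega))).trans ?_
    have h1 := hthr p q hp hq s hs hps hsN n hm f hfd hfb
    have h2 := MultiThreshold.rate_trainSize_le hn32 hs0
    have h3 := MultiThreshold.card_indexSet_div_learnSize_le hn32 hs0 hsN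
    set R := (n : ℝ) ^ (-(2 * s) / (2 * s + 1)) with hR
    have h4 : (2 * ((MultiThreshold.indexSet n).card : ℝ) +
        16 * B * ((MultiThreshold.indexSet n).card + 1)) / MultiThreshold.learnSize n ≤ D * R := by
      have hl' : (0 : ℝ) < MultiThreshold.learnSize n := by exact_mod_cast hl
      have hc : (1 : ℝ) ≤ (MultiThreshold.indexSet n).card := by
        simp [MultiThreshold.indexSet]
      calc _ ≤ (2 + 32 * B) * (MultiThreshold.indexSet n).card / MultiThreshold.learnSize n := by
            gcongr
            nlinarith
        _ = (2 + 32 * B) *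
            ((MultiThreshold.indexSet n).card / MultiThreshold.learnSize n) := by ring
        _ ≤ (2 + 32 * B) * (2 * (2 * (2 * N + 1)) ^ 2 * R) := by gcongr
        _ = D * R := by rw [hD]; ring
    calc _ ≤ 3 * ENNReal.ofReal (K * (2 * R)) + ENNReal.ofReal (D * R) := by
          gcongr
          exact h1.trans (by gcongr)
      _ = ENNReal.ofReal (3 * (K * (2 * R)) + D * R) := by
          rw [ENNReal.ofReal_add (by positivity) (by positivity),
            ENNReal.ofReal_mul (p := 3) (by norm_num)]
          simp
      _ ≤ _ := by
          refine ENNReal.ofReal_le_ofReal ?_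
          have : 0 ≤ 32 * B ^ 2 * R := by positivity
          linarith
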